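/- Let $k$ be an algebraically closed field (of any characteristic). Let $k[[t^{\mathbb Q}]]$ be the Hahn field of formal series $\alpha=\sum_{s\in\mathbb Q}a_st^s$ with $a_s\in k$ and well-ordered support $\operatorname{supp}(\alpha)=\{s : a_s\ne 0\}$, with valuation $\nu(\alpha)=\min\operatorname{supp}(\alpha)$ (and $\nu(0)=\infty$). For a subfield $K\subseteq k[[t^{\mathbb Q}]]$ put $K^+=\{b\in K : \nu(b)\ge 0\}$. A subring $A\subsetneq R$ of a commutative ring $R$ is called maximal if there is no ring strictly between $A$ and $R$; a maximal subring is extending if $\operatorname{Spec} R\to\operatorname{Spec} A$ is not surjective. A crucial maximal ideal of $A$ in $R$ is a maximal ideal $\mathfrak m$ of $A$ such that $\varphi:\operatorname{Spec} R\to\operatorname{Spec}A$ induces an isomorphism of schemes $\operatorname{Spec}R\setminus\varphi^{-1}(\mathfrak m)\to\operatorname{Spec}A\setminus\{\mathfrak m\}$. **(1)** Let $K\subseteq k[[t^{\mathbb Q}]]$ be an algebraically closed subfield that contains $k(t)$ and has the cutoff property: if $\sum_s a_st^s\in K$ and $u\in\mathbb Q$, then $\sum_{s\ge u}a_st^s\in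 K$. An admissible pair $(S,\Lambda)$ of $K$ consists of a strictly increasing infinite sequence $S=\{s_1<s_2<\dots\}$ in $\mathbb Q_{\ge 0}$ and a sequence $\Lambda=\{\alpha_1,\alpha_2,\dots\}$ in $K$ such that $\operatorname{supp}(\alpha_i)\subseteq[0,s_i)$ and $\operatorname{supp}(\alpha_{i+1}-\alpha_i)\subseteq[s_i,s_{i+1})$ for all $i$; a limit of it in $K$ is an $\alpha\in K$ with $\operatorname{supp}(\alpha-\alpha_i)\subseteq[s_i,\infty)$ for all $i$. A subring of $K[y]$ is a maximal subring that contains $K^+[y]$ if and only if it is equal to $$K^+\left[\left\{\tfrac{y-\alpha_i}{t^{s_i}} : i=1,2,\dots\right\}\right]$$ for some admissible pair $(S,\Lambda)$ of $K$ such that $\lim s_i=\infty$ or $(S,\Lambda)$ has no limit in $K$. **(2)** Let $K=k[[t^{\mathbb Q}]]$. For every $\alpha\in K^+$ the ring $A_\alpha=K^+\left[\left\{\tfrac{y-\alpha}{t^{s}} : s=1,2,\dots\right\}\right]$ is a maximal subring of $K[y]$ that contains $K^+[y]$, and every maximal subring of $K[y]$ that contains $K^+[y]$ is of this form. Moreover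 $A_\alpha=K^++(y-\alpha)K[y]$, and $A_\alpha$ has exactly one crucial maximal ideal in $K[y]$, namely $\mathfrak n+(y-\alpha)K[y]$, where $\mathfrak n=\{b\in K:\nu(b)>0\}$ is the unique maximal ideal of $K^+$. **(3)** Let $K=k[[t^{\mathbb Q}]]$. The map $\alpha\mapsto K^++(y-\alpha)K[y]$ is a bijection from $K^+$ onto the set of maximal subrings of $K[y]$ that contain $K^+[y]$, and also a bijection from $K^+$ onto the set of extending maximal $k$-subalgebras of $K[y]$ that contain $K^+[y]$ (that is, of those subrings containing $K^+[y]$ that are maximal among the proper $k$-subalgebras of $K[y]$ and are extending maximal subrings of $K[y]$). -/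

import Mathlib

open Polynomial Filter

noncomputable section

namespace MaxSubring

/-! ### Maximal subrings -/

section General

variable {R : Type*} [CommRing R]

/-- `A ⊊ R` is a maximal subring: there is no ring strictly between `A` and `R`. -/
def IsMaximalSubring (A : Subring R) : Prop :=
  A ≠ ⊤ ∧ ∀ B : Subring R, A ≤ B → B = A ∨ B = ⊤

/-- An extending maximal subring: `Spec R → Spec A` is not surjective. -/
def IsExtendingMaximalSubring (A : Subring R) : Prop :=
  IsMaximalSubring A ∧ ¬ Function.Surjective (PrimeSpectrum.comap A.subtype)

/-- A maximal `k`-subalgebra of the `k`-algebra `R` with structure map `i : k → R`: a proper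
subring `A` of `R` that contains the image of `k`, such that there is no subring with that property
strictly between `A` and `R`. -/
def IsMaximalSubalgebra {k : Type*} [Field k] (i : k →+* R) (A : Subring R) : Prop :=
  i.range ≤ A ∧ A ≠ ⊤ ∧ ∀ B : Subring R, i.range ≤ B → A ≤ B → B = A ∨ B = ⊤

/-- The open subscheme `Spec A ∖ {𝔪}` of `Spec A`, for a maximal ideal `𝔪` of `A`. -/
def complOfClosedPoint {A : Type*} [CommRing A] (m : Ideal A) (hm : m.IsMaximal) :
    (AlgebraicGeometry.Spec (CommRingCat.of A)).Opens :=
  ⟨({⟨m, hm.isPrime⟩} : Set (PrimeSpectrum A))ᶜ,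
    ((PrimeSpectrum.isClosed_singleton_iff_isMaximal _).2 hm).isOpen_compl⟩

/-- `𝔪` is a crucial maximal ideal of the subring `A ⊆ R`: the morphism `φ : Spec R → Spec A`
induces an isomorphism of schemes `Spec R ∖ φ⁻¹(𝔪) ≅ Spec A ∖ {𝔪}`. -/
def IsCrucialMaximalIdeal (A : Subring R) (m : Ideal A) : Prop :=
  ∃ hm : m.IsMaximal, CategoryTheory.IsIso
    (AlgebraicGeometry.morphismRestrict
      (AlgebraicGeometry.Spec.map (CommRingCat.ofHom A.subtype)) (complOfClosedPoint m hm))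

/-- `V[y]` as a subring of `R[y]`, for a subring `V ⊆ R`. -/
def polynomialSubring (V : Subring R) : Subring R[X] :=
  (Polynomial.mapRingHom V.subtype).range

/-- The subring `V[G]` of `R[y]` generated over the subring `V ⊆ R` by `G ⊆ R[y]`. -/
def adjoinSubring (V : Subring R) (G : Set R[X]) : Subring R[X] :=
  (Algebra.adjoin V G).toSubring

/-- The subring `V + (y - a) R[y]` of `R[y]`, for a subring `V ⊆ R` and `a ∈ R`. -/
def pointSubring (V : Subring R) (a : R) : Subring R[X] where
  carrier := {f | ∃ c ∈ V, ∃ g : R[X], f = C c + (X - C a) * g}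
  mul_mem' := by
    rintro _ _ ⟨c, hc, g, rfl⟩ ⟨d, hd, h, rfl⟩
    exact ⟨c * d, V.mul_mem hc hd, C c * h + g * C d + g * (X - C a) * h, by
      rw [C_mul]; ring⟩
  one_mem' := ⟨1, V.one_mem, 0, by simp⟩
  add_mem' := by
    rintro _ _ ⟨c, hc, g, rfl⟩ ⟨d, hd, h, rfl⟩
    exact ⟨c + d, V.add_mem hc hd, g + h, by rw [C_add]; ring⟩
  zero_mem' := ⟨0, V.zero_mem, 0, by simp⟩
  neg_mem' := by
    rintro _ ⟨c, hc, g, rfl⟩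
    exact ⟨-c, V.neg_mem hc, -g, by rw [C_neg]; ring⟩

/-- The ideal `I + (y - a) R[y]` of `V + (y - a) R[y]`, for an ideal `I` of `V`. -/
def pointIdeal (V : Subring R) (I : Ideal V) (a : R) : Ideal (pointSubring V a) where
  carrier := {f | ∃ c ∈ I, ∃ g : R[X], (f : R[X]) = C (c : R) + (X - C a) * g}
  add_mem' := by
    rintro _ _ ⟨c, hc, g, hf⟩ ⟨d, hd, h, hf'⟩
    exact ⟨c + d, I.add_mem hc hd, g + h, by
      rw [Subring.coe_add, Subring.coe_add, hf, hf', C_add]; ring⟩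
  zero_mem' := ⟨0, I.zero_mem, 0, by simp⟩
  smul_mem' := by
    rintro ⟨_, ⟨c, hc, g, rfl⟩⟩ _ ⟨d, hd, h, hf⟩
    exact ⟨⟨c, hc⟩ * d, I.mul_mem_left _ hd, C c * h + g * C (d : R) + g * (X - C a) * h, by
      rw [smul_eq_mul, Subring.coe_mul, Subring.coe_mul, hf, C_mul]; ring⟩

end General

/-! ### The Hahn field -/

/-- The Hahn field `k[[t^ℚ]]`. -/
abbrev HahnField (k : Type*) [Field k] : Type _ := HahnSeries ℚ k

section Hahn

variable (k : Type*) [Field k]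

/-- The valuation ring `k[[t^ℚ]]⁺` of the valuation `ν(α) = min supp(α)`. -/
def hahnPlus : Subring (HahnField k) where
  carrier := {x | 0 ≤ HahnSeries.addVal ℚ k x}
  mul_mem' := by
    intro a b ha hb
    simp only [Set.mem_ofPred_eq, AddValuation.map_mul] at *
    exact add_nonneg ha hb
  one_mem' := by simp
  add_mem' := by
    intro a b ha hb
    simp only [Set.mem_ofPred_eq] at *
    exact AddValuation.map_le_add _ ha hb
  zero_mem' := by simp
  neg_mem' := by
    intro a ha
    simpa only [Set.mem_ofPred_eq, AddValuation.map_neg] using ha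

theorem mem_hahnPlus {x : HahnField k} : x ∈ hahnPlus k ↔ 0 ≤ HahnSeries.addVal ℚ k x := by
  simp only [hahnPlus, ← SetLike.mem_coe, Subring.coe_set_mk, Subsemiring.coe_set_mk,
    Submonoid.coe_set_mk, Subsemigroup.coe_set_mk, Set.mem_ofPred_eq]

/-- The ideal `𝔫` of elements of positive valuation in `k[[t^ℚ]]⁺`. -/
def hahnMaximalIdeal : Ideal (hahnPlus k) where
  carrier := {x | 0 < HahnSeries.addVal ℚ k (x : HahnField k)}
  add_mem' := by
    intro a b ha hb
    simp only [Set.mem_ofPred_eq] at *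
    exact AddValuation.map_lt_add _ ha hb
  zero_mem' := by simp
  smul_mem' := by
    intro c x hx
    simp only [Set.mem_ofPred_eq, smul_eq_mul, Subring.coe_mul, AddValuation.map_mul] at *
    exact lt_of_lt_of_le hx (le_add_of_nonneg_left ((mem_hahnPlus k).1 c.2))

theorem mem_hahnMaximalIdeal {x : hahnPlus k} :
    x ∈ hahnMaximalIdeal k ↔ 0 < HahnSeries.addVal ℚ k (x : HahnField k) := by
  simp only [hahnMaximalIdeal, ← SetLike.mem_coe, Submodule.coe_set_mk, AddSubmonoid.coe_set_mk,
    AddSubsemigroup.coe_set_mk, Set.mem_ofPred_eq]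

variable {k}

/-- `𝔫` is the unique maximal ideal of `k[[t^ℚ]]⁺`. -/
theorem isMaximal_iff_eq_hahnMaximalIdeal (I : Ideal (hahnPlus k)) :
    I.IsMaximal ↔ I = hahnMaximalIdeal k := by
  have hne : hahnMaximalIdeal k ≠ ⊤ := by
    intro h
    have h1 : (1 : hahnPlus k) ∈ hahnMaximalIdeal k := by rw [h]; trivial
    have h2 : 0 < HahnSeries.addVal ℚ k ((1 : hahnPlus k) : HahnField k) :=
      (mem_hahnMaximalIdeal k).1 h1
    simp at h2
  have hle : ∀ J : Ideal (hahnPlus k), J ≠ ⊤ → J ≤ hahnMaximalIdeal k := by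
    intro J hJ x hx
    by_contra hxn
    apply hJ
    have h0 : HahnSeries.addVal ℚ k (x : HahnField k) = 0 :=
      le_antisymm (not_lt.1 fun h => hxn ((mem_hahnMaximalIdeal k).2 h))
        ((mem_hahnPlus k).1 x.2)
    have hx0 : (x : HahnField k) ≠ 0 := by
      intro h; rw [h] at h0; simp at h0
    have hinv : (x : HahnField k)⁻¹ ∈ hahnPlus k := by
      rw [mem_hahnPlus]
      have h3 : HahnSeries.addVal ℚ k ((x : HahnField k) * (x : HahnField k)⁻¹) = 0 := by
        rw [mul_inv_cancel₀ hx0]; simp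
      rw [AddValuation.map_mul, h0, zero_add] at h3
      exact h3.ge
    rw [Ideal.eq_top_iff_one]
    have h4 : (⟨_, hinv⟩ : hahnPlus k) * x = 1 :=
      Subtype.ext (inv_mul_cancel₀ hx0)
    rw [← h4]
    exact J.mul_mem_left _ hx
  constructor
  · intro hI
    exact hI.eq_of_le hne (hle I hI.ne_top)
  · rintro rfl
    refine ⟨⟨hne, fun J hJ => ?_⟩⟩
    by_contra h
    exact absurd (hle J h) (not_le_of_gt hJ)

variable (k)

/-- The subfield `k(t)` of `k[[t^ℚ]]`. -/
def rationalFunctions : Subfield (HahnField k) :=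
  Subfield.closure (Set.range (HahnSeries.C : k →+* HahnField k) ∪ {HahnSeries.single 1 1})

/-- The structure map `k → k[[t^ℚ]][y]` of the `k`-algebra `k[[t^ℚ]][y]`. -/
def constants : k →+* (HahnField k)[X] :=
  (Polynomial.C : HahnField k →+* (HahnField k)[X]).comp HahnSeries.C

variable {k}

/-- `K⁺ = {b ∈ K | ν(b) ≥ 0}`, as a subring of the subfield `K ⊆ k[[t^ℚ]]`. -/
def plus (K : Subfield (HahnField k)) : Subring K :=
  (hahnPlus k).comap K.subtype

/-- The cutoff property: if `∑ₛ aₛ tˢ ∈ K` and `u ∈ ℚ`, then `∑_{s ≥ u} aₛ tˢ ∈ K`. -/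
def HasCutoffProperty (K : Subfield (HahnField k)) : Prop :=
  ∀ a ∈ K, ∀ u : ℚ, ∃ b ∈ K, ∀ s : ℚ, b.coeff s = if u ≤ s then a.coeff s else 0

/-- An algebraically closed subfield of `k[[t^ℚ]]` containing `k(t)` contains all `tˢ`. -/
theorem single_mem (K : Subfield (HahnField k)) [IsAlgClosed K]
    (hK : rationalFunctions k ≤ K) (s : ℚ) : (HahnSeries.single s 1 : HahnField k) ∈ K := by
  have ht : (HahnSeries.single (1 : ℚ) 1 : HahnField k) ∈ K :=
    hK (Subfield.subset_closure (Or.inr rfl))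
  have hden : (s.den : ℕ) ≠ 0 := s.den_nz
  have hz : ∀ n : ℕ, (HahnSeries.single (n : ℚ) 1 : HahnField k) ∈ K := by
    intro n
    have h : (HahnSeries.single (n : ℚ) 1 : HahnField k) = (HahnSeries.single 1 1) ^ n := by
      rw [HahnSeries.single_pow]; simp
    rw [h]
    exact K.pow_mem ht n
  have hnum : (HahnSeries.single (s.num : ℚ) 1 : HahnField k) ∈ K := by
    rcases Int.eq_nat_or_neg s.num with ⟨n, h | h⟩
    · rw [h]; exact_mod_cast hz n
    · have h' : (HahnSeries.single (s.num : ℚ) 1 : HahnField k)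
          = (HahnSeries.single (n : ℚ) 1)⁻¹ := by
        refine eq_inv_of_mul_eq_one_left ?_
        rw [HahnSeries.single_mul_single, h]
        simp
      rw [h']
      exact K.inv_mem (hz n)
  have hp : (HahnSeries.single s 1 : HahnField k) ^ s.den
      = algebraMap K (HahnField k) ⟨_, hnum⟩ := by
    rw [HahnSeries.single_pow]
    simp only [nsmul_eq_mul, one_pow, Rat.den_mul_eq_num]
    rfl
  have hint : IsIntegral K (HahnSeries.single s 1 : HahnField k) := by
    refine IsIntegral.of_pow (Nat.pos_of_ne_zero hden) ?_
    rw [hp]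
    exact isIntegral_algebraMap
  obtain ⟨x, hx⟩ := minpoly.mem_range_of_degree_eq_one K _
    (IsAlgClosed.degree_eq_one_of_irreducible K (minpoly.irreducible hint))
  rw [← hx]
  exact x.2

/-- The element `tˢ` of `K`. -/
def tPow (K : Subfield (HahnField k)) [IsAlgClosed K]
    (hK : rationalFunctions k ≤ K) (s : ℚ) : K :=
  ⟨HahnSeries.single s 1, single_mem K hK s⟩

/-- Admissible pairs `(S, Λ)` of `K`, where `S = {s 0 < s 1 < …}` and `Λ = {a 0, a 1, …}`. -/
structure IsAdmissiblePair (K : Subfield (HahnField k)) (s : ℕ → ℚ) (a : ℕ → K) : Prop where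
  nonneg : ∀ i, 0 ≤ s i
  strictMono : StrictMono s
  support_subset : ∀ i, (a i : HahnField k).support ⊆ Set.Ico 0 (s i)
  support_sub_subset : ∀ i,
    ((a (i + 1) : HahnField k) - (a i : HahnField k)).support ⊆ Set.Ico (s i) (s (i + 1))

/-- `b ∈ K` is a limit of the admissible pair `(s, a)`. -/
def IsLimitOfPair (K : Subfield (HahnField k)) (s : ℕ → ℚ) (a : ℕ → K) (b : K) : Prop :=
  ∀ i, ((b : HahnField k) - (a i : HahnField k)).support ⊆ Set.Ici (s i)

/-- The subring `K⁺[{(y - aᵢ) / t^{sᵢ}}]` of `K[y]`. -/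
def pairSubring (K : Subfield (HahnField k)) [IsAlgClosed K]
    (hK : rationalFunctions k ≤ K) (s : ℕ → ℚ) (a : ℕ → K) : Subring K[X] :=
  adjoinSubring (plus K) (Set.range fun i => C (tPow K hK (s i))⁻¹ * (X - C (a i)))

/-- The subring `k[[t^ℚ]]⁺[{(y - α) / tⁿ | n = 1, 2, …}]` of `k[[t^ℚ]][y]`. -/
def hahnGeneratedSubring (α : HahnField k) : Subring (HahnField k)[X] :=
  adjoinSubring (hahnPlus k)
    {f | ∃ n : ℕ, 1 ≤ n ∧ f = C (HahnSeries.single (n : ℚ) (1 : k))⁻¹ * (X - C α)}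

end Hahn

end MaxSubring

end

open MaxSubring

/-! Write `ν` for the valuation, `V` for the valuation ring, `t^s` for the monomials and `A` for a
subring of `K[y]` containing `V[y]`. Such an `A` is everything as soon as it contains some `t^(-ε)`
with `ε > 0`, so maximality amounts to this: adjoining any new element produces such a `t^(-ε)`.

Maximality of the listed rings. The ring `V + (y - b)K[y]` consists of the `f` with `f(b) ∈ V`;
subtracting `f - f(b)` from a new `f` leaves a constant outside `V`. For an admissible pair without
limit, every `c` separates from some `α_i` before `s_i`, which makes `y - c` a constant times `1 +
t^δ b` with `δ > 0` and `b ∈ A`. This form is stable under products, and `K` is algebraically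
closed, so every polynomial is a constant up to a small relative error.

Conversely, let `A` be maximal. A degree-reduction argument in the style of Chevalley
(`mem_valuesLT_of_mul_mem`) shows that the complement of `A` is multiplicatively closed, so `A`
behaves like a valuation ring. Call `(y - c)/t^s ∈ A` an approximation of order `s` by `c`. If some
`b` is at least as good as every other center, then it approximates to all orders
(`forall_inv_mul_mem_of_center`). Otherwise there is an increasing sequence of orders, cofinal among
those attained, and no single center reaches them all. Truncating the centers by the cutoff property
gives an admissible pair whose ring lies in `A`, and this ring is already maximal, so it equals `A`.

Over the full Hahn field, compatible approximations glue to a series, so only rings with a center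
`b` survive. The argument needs the Hahn field to be algebraically closed in every characteristic.
In an algebraic extension neither the value group `ℚ` nor the residue field `k` can grow, so an
element outside the Hahn field could be approximated ever better, against gluing.

Finally `K[y]` is the localization of `V + (y - b)K[y]` at `t`, and the only prime containing `t` is
`𝔫 + (y - b)K[y]`. This gives the crucial maximal ideal and the failure of surjectivity on spectra.
-/

namespace MaxSubring

/-! ### Maximal subrings and multiplicatively closed complements -/

section Complement

variable {R : Type*} [CommRing R]

/-- The elements `p(f)`, for `p` a polynomial of degree `< n` with coefficients in `A`. -/
noncomputable def valuesLT (A : Subring R) (f : R) (n : ℕ) : Submodule A R :=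
  (degreeLT A n).map (aeval f).toLinearMap

theorem pow_mem_valuesLT (A : Subring R) (f : R) {i n : ℕ} (h : i < n) :
    f ^ i ∈ valuesLT A f n := by
  refine ⟨X ^ i, ?_, by simp⟩
  rw [SetLike.mem_coe, mem_degreeLT]
  exact lt_of_le_of_lt (degree_X_pow_le i) (by exact_mod_cast h)

theorem mul_mem_valuesLT {A : Subring R} {f a x : R} {n : ℕ} (ha : a ∈ A)
    (hx : x ∈ valuesLT A f n) : a * x ∈ valuesLT A f n :=
  (valuesLT A f n).smul_mem (⟨a, ha⟩ : A) hx

theorem exists_sum_of_mem_valuesLT {A : Subring R} {f x : R} {n : ℕ}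
    (hx : x ∈ valuesLT A f n) :
    ∃ a : ℕ → R, (∀ i, a i ∈ A) ∧ x = ∑ i ∈ Finset.range n, a i * f ^ i := by
  obtain ⟨p, hp, rfl⟩ := hx
  rw [SetLike.mem_coe, mem_degreeLT] at hp
  refine ⟨fun i => p.coeff i, fun i => (p.coeff i).2, ?_⟩
  change aeval f p = _
  rw [aeval_def, eval₂_eq_sum, Finset.sum_range, ← sum_fin _ (by simp) hp]
  rfl

theorem exists_mem_valuesLT_of_isMaximalSubring {A : Subring R} (hA : IsMaximalSubring A)
    {f : R} (hf : f ∉ A) (x : R) : ∃ n, x ∈ valuesLT A f n := by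
  have hle : A ≤ (Algebra.adjoin A {f}).toSubring := fun a ha =>
    (Algebra.adjoin A {f}).algebraMap_mem ⟨a, ha⟩
  have hmem : f ∈ (Algebra.adjoin A {f}).toSubring :=
    Algebra.subset_adjoin (Set.mem_singleton f)
  have hx : x ∈ (Algebra.adjoin A {f}).toSubring := by
    rcases hA.2 _ hle with h | h
    · exact absurd (h ▸ hmem) hf
    · rw [h]; trivial
  have hx' : x ∈ Algebra.adjoin A {f} := hx
  rw [Algebra.adjoin_singleton_eq_range_aeval] at hx'
  obtain ⟨p, rfl⟩ := hx'
  refine ⟨p.natDegree + 1, p, ?_, rfl⟩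
  rw [SetLike.mem_coe, mem_degreeLT]
  exact lt_of_le_of_lt degree_le_natDegree (by exact_mod_cast Nat.lt_succ_self _)

/-- If `x` has degree at most `n` in `f` and at most `m ≤ n` in `g`, then the relation `f * g ∈ A`
trades the leading power of `f` for lower ones, and `n` drops. Expressing `x = t⁻¹` instead of `1`
avoids any assumption that `A` is local. -/
theorem mem_valuesLT_of_mul_mem {A : Subring R} {t x f g : R} (ht : t ∈ A) (htx : t * x = 1)
    (hfg : f * g ∈ A) {n m : ℕ} (hmn : m ≤ n) (hn : 0 < n)
    (hf : x ∈ valuesLT A f (n + 1)) (hg : x ∈ valuesLT A g (m + 1)) :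
    x ∈ valuesLT A f n := by
  obtain ⟨a, ha, hxa⟩ := exists_sum_of_mem_valuesLT hf
  obtain ⟨b, hb, hxb⟩ := exists_sum_of_mem_valuesLT hg
  rw [Finset.sum_range_succ] at hxa
  rw [Finset.sum_range_succ'] at hxb
  have hy : f ^ n * ∑ j ∈ Finset.range m, b (j + 1) * g ^ (j + 1) =
      ∑ j ∈ Finset.range m, b (j + 1) * (f * g) ^ (j + 1) * f ^ (n - (j + 1)) := by
    rw [Finset.mul_sum]
    refine Finset.sum_congr rfl fun j hj => ?_
    have hj' : n = (j + 1) + (n - (j + 1)) := by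
      have := Finset.mem_range.1 hj
      omega
    rw [mul_pow]
    conv_lhs => rw [hj', pow_add]
    ring
  have hz : ∑ j ∈ Finset.range m, b (j + 1) * (f * g) ^ (j + 1) * f ^ (n - (j + 1)) ∈
      valuesLT A f n := by
    refine Submodule.sum_mem _ fun j hj => ?_
    have := Finset.mem_range.1 hj
    exact mul_mem_valuesLT (A.mul_mem (hb _) (A.pow_mem hfg _)) (pow_mem_valuesLT A f (by omega))
  have hw : ∑ i ∈ Finset.range n, a i * f ^ i ∈ valuesLT A f n :=
    Submodule.sum_mem _ fun i hi =>
      mul_mem_valuesLT (ha i) (pow_mem_valuesLT A f (Finset.mem_range.1 hi))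
  have h1 : (b 0 : R) ∈ valuesLT A f n := by
    have := mul_mem_valuesLT (hb 0) (pow_mem_valuesLT A f hn)
    simpa using this
  rw [← hy] at hz
  set S := ∑ i ∈ Finset.range n, a i * f ^ i
  set T := ∑ j ∈ Finset.range m, b (j + 1) * g ^ (j + 1)
  -- Here `1 - t * b 0 = t * (x - b 0) = t * T`, so multiplying `x = S + a n * f ^ n` by it turns
  -- the leading term into `a n * t * (f ^ n * T)`, which has degree below `n` in `f`. The missing
  -- `t * b 0 * x` is just `b 0`.
  have key : x = (1 - t * b 0) * S + (a n * t) * (f ^ n * T) + b 0 := by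
    linear_combination (1 - t * b 0) * hxa + (a n * t) * f ^ n * hxb + (b 0 - a n * f ^ n) * htx
  rw [key]
  exact add_mem (add_mem
    (mul_mem_valuesLT (A.sub_mem A.one_mem (A.mul_mem ht (hb 0))) hw)
    (mul_mem_valuesLT (A.mul_mem (ha n) ht) hz)) h1

/-- A maximal subring with an element that becomes invertible in the big ring has a
multiplicatively closed complement. -/
theorem IsMaximalSubring.mem_or_mem_of_mul_mem {A : Subring R} (hA : IsMaximalSubring A)
    {t x : R} (ht : t ∈ A) (htx : t * x = 1) (hx : x ∉ A) {f g : R} (hfg : f * g ∈ A) :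
    f ∈ A ∨ g ∈ A := by
  by_contra! hcon
  have hzero : ∀ f : R, x ∉ valuesLT A f 1 := by
    intro f h
    obtain ⟨a, ha, h⟩ := exists_sum_of_mem_valuesLT h
    apply hx
    rw [h]
    simpa using ha 0
  have mono : ∀ (f : R) (n : ℕ), x ∈ valuesLT A f n → x ∈ valuesLT A f (n + 1) := by
    intro f n
    exact fun h => Submodule.map_mono (degreeLT_mono (Nat.le_succ n)) h
  -- Descent on the sum of the two degrees: the larger one is lowered each time and the roles are
  -- exchanged when needed. Degree `0` would put `x` in `A`.
  have main : ∀ N n m : ℕ, n + m ≤ N → ∀ f g : R, f * g ∈ A → m ≤ n →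
      x ∈ valuesLT A f (n + 1) → x ∈ valuesLT A g (m + 1) → False := by
    intro N
    induction N with
    | zero =>
      intro n m hN f g _ _ hf _
      obtain rfl : n = 0 := by omega
      exact hzero f hf
    | succ N ih =>
      intro n m hN f g hfg hmn hf hg
      rcases n with _ | n
      · exact hzero f hf
      · have h := mem_valuesLT_of_mul_mem ht htx hfg hmn n.succ_pos hf hg
        rcases le_total m n with h' | h'
        · exact ih n m (by omega) f g hfg h' h hg
        · exact ih m n (by omega) g f (by rwa [mul_comm]) h' hg h
  obtain ⟨n, hn⟩ := exists_mem_valuesLT_of_isMaximalSubring hA hcon.1 x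
  obtain ⟨m, hm⟩ := exists_mem_valuesLT_of_isMaximalSubring hA hcon.2 x
  rcases le_total m n with h | h
  · exact main _ n m le_rfl f g hfg h (mono _ _ hn) (mono _ _ hm)
  · exact main _ m n le_rfl g f (by rwa [mul_comm]) h (mono _ _ hm) (mono _ _ hn)

end Complement

/-! ### Rings with monomials -/

section Monomial

variable {K : Type*} [Field K]

/-- A family `τ s`, `s ∈ ℚ`, of monomials for the subring `V` of the field `K`: the elements of
`Kˣ` are the products of monomials and units of `V`. -/
structure IsMonomialFamily (V : Subring K) (τ : ℚ → K) : Prop where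
  map_zero : τ 0 = 1
  map_add : ∀ s r, τ (s + r) = τ s * τ r
  mem_iff : ∀ s, τ s ∈ V ↔ 0 ≤ s
  exists_eq_mul : ∀ x, x ≠ 0 → ∃ s u, u ∈ V ∧ u⁻¹ ∈ V ∧ u ≠ 0 ∧ x = τ s * u

namespace IsMonomialFamily

variable {V : Subring K} {τ : ℚ → K}

theorem ne_zero (h : IsMonomialFamily V τ) (s : ℚ) : τ s ≠ 0 := by
  intro h0
  have := h.map_add s (-s)
  rw [add_neg_cancel, h.map_zero, h0, zero_mul] at this
  exact one_ne_zero this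

theorem map_neg (h : IsMonomialFamily V τ) (s : ℚ) : τ (-s) = (τ s)⁻¹ := by
  refine eq_inv_of_mul_eq_one_left ?_
  rw [← h.map_add, neg_add_cancel, h.map_zero]

theorem map_nsmul (h : IsMonomialFamily V τ) (n : ℕ) (s : ℚ) : τ (n * s) = τ s ^ n := by
  induction n with
  | zero => simp [h.map_zero]
  | succ n ih => rw [Nat.cast_succ, add_mul, one_mul, h.map_add, ih, pow_succ]

theorem div_eq (h : IsMonomialFamily V τ) (s r : ℚ) : (τ s)⁻¹ * τ r = τ (r - s) := by
  rw [sub_eq_neg_add, h.map_add, h.map_neg]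

theorem mul_mem_iff (_ : IsMonomialFamily V τ) {x u : K} (hu : u ∈ V) (hu' : u⁻¹ ∈ V)
    (hu0 : u ≠ 0) : x * u ∈ V ↔ x ∈ V := by
  refine ⟨fun hx => ?_, fun hx => V.mul_mem hx hu⟩
  have := V.mul_mem hx hu'
  rwa [mul_assoc, mul_inv_cancel₀ hu0, mul_one] at this

theorem not_mem (h : IsMonomialFamily V τ) {x : K} (hx : x ∉ V) :
    ∃ ε u, 0 < ε ∧ u ∈ V ∧ u⁻¹ ∈ V ∧ u ≠ 0 ∧ x = (τ ε)⁻¹ * u := by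
  have hx0 : x ≠ 0 := by
    rintro rfl
    exact hx V.zero_mem
  obtain ⟨s, u, hu, hu', hu0, rfl⟩ := h.exists_eq_mul x hx0
  refine ⟨-s, u, ?_, hu, hu', hu0, by rw [h.map_neg, inv_inv]⟩
  rw [h.mul_mem_iff hu hu' hu0, h.mem_iff] at hx
  linarith

end IsMonomialFamily

theorem polynomialSubring_le_iff {V : Subring K} {A : Subring K[X]} :
    polynomialSubring V ≤ A ↔ (∀ c ∈ V, C c ∈ A) ∧ X ∈ A := by
  constructor
  · intro h
    refine ⟨fun c hc => h ⟨C ⟨c, hc⟩, by simp⟩, h ⟨X, by simp⟩⟩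
  · rintro ⟨hC, hX⟩ _ ⟨p, rfl⟩
    induction p using Polynomial.induction_on' with
    | add p q hp hq => rw [map_add]; exact A.add_mem hp hq
    | monomial n a =>
      rw [coe_mapRingHom, map_monomial, ← C_mul_X_pow_eq_monomial]
      exact A.mul_mem (hC _ a.2) (A.pow_mem hX n)

theorem C_mem_adjoinSubring {V : Subring K} (G : Set K[X]) {c : K} (hc : c ∈ V) :
    C c ∈ adjoinSubring V G :=
  (Algebra.adjoin V G).algebraMap_mem ⟨c, hc⟩

theorem subset_adjoinSubring (V : Subring K) (G : Set K[X]) {g : K[X]} (hg : g ∈ G) :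
    g ∈ adjoinSubring V G :=
  Algebra.subset_adjoin hg

theorem adjoinSubring_induction {V : Subring K} {G : Set K[X]} {p : K[X] → Prop}
    (mem : ∀ g ∈ G, p g) (const : ∀ c ∈ V, p (C c)) (add : ∀ f g, p f → p g → p (f + g))
    (mul : ∀ f g, p f → p g → p (f * g)) {f : K[X]} (hf : f ∈ adjoinSubring V G) : p f := by
  change f ∈ Algebra.adjoin V G at hf
  induction hf using Algebra.adjoin_induction with
  | mem x hx => exact mem x hx
  | algebraMap c => exact const _ c.2
  | add x y _ _ hx hy => exact add x y hx hy
  | mul x y _ _ hx hy => exact mul x y hx hy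

theorem adjoinSubring_le {V : Subring K} {G : Set K[X]} {A : Subring K[X]}
    (hV : ∀ c ∈ V, C c ∈ A) (hG : ∀ g ∈ G, g ∈ A) : adjoinSubring V G ≤ A := fun _ hf =>
  adjoinSubring_induction hG hV (fun _ _ => A.add_mem) (fun _ _ => A.mul_mem) hf

theorem induction_on_linear [IsAlgClosed K] {p : K[X] → Prop} (const : ∀ c, p (C c))
    (linear : ∀ c, p (X - C c)) (mul : ∀ f g, p f → p g → p (f * g)) (f : K[X]) : p f := by
  rw [(IsAlgClosed.splits f).eq_prod_roots]
  refine mul _ _ (const _) ?_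
  induction f.roots using Multiset.induction_on with
  | empty => simpa using const 1
  | cons a s ih =>
    rw [Multiset.map_cons, Multiset.prod_cons]
    exact mul _ _ (linear a) ih

variable {V : Subring K} {τ : ℚ → K}

theorem eq_top_of_C_inv_mem (h : IsMonomialFamily V τ) {A : Subring K[X]}
    (hA : polynomialSubring V ≤ A) {ε : ℚ} (hε : 0 < ε) (hm : C (τ ε)⁻¹ ∈ A) : A = ⊤ := by
  obtain ⟨hC, hX⟩ := polynomialSubring_le_iff.1 hA
  have hall : ∀ c, C c ∈ A := by
    intro c
    rcases eq_or_ne c 0 with rfl | hc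
    · simp
    obtain ⟨s, u, hu, -, -, rfl⟩ := h.exists_eq_mul c hc
    -- Large enough that `t^(s + nε)` lies in `V`; then `t^s` is this monomial times the `n`-th
    -- power of `t^(-ε)`.
    obtain ⟨n, hn⟩ := exists_nat_ge (-s / ε)
    rw [div_le_iff₀ hε] at hn
    have h1 : τ s = ((τ ε)⁻¹) ^ n * τ (s + n * ε) := by
      rw [h.map_add, h.map_nsmul, inv_pow, mul_comm (τ s), inv_mul_cancel_left₀]
      exact pow_ne_zero _ (h.ne_zero _)
    rw [h1, C_mul, C_mul, C_pow]
    exact A.mul_mem (A.mul_mem (A.pow_mem hm n) (hC _ ((h.mem_iff _).2 (by linarith)))) (hC _ hu)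
  refine (Subring.eq_top_iff' A).2 fun p => ?_
  induction p using Polynomial.induction_on' with
  | add p q hp hq => exact A.add_mem hp hq
  | monomial n a =>
    rw [← C_mul_X_pow_eq_monomial]
    exact A.mul_mem (hall a) (A.pow_mem hX n)

theorem mem_of_C_mem (h : IsMonomialFamily V τ) {A : Subring K[X]}
    (hA : polynomialSubring V ≤ A) (hA' : A ≠ ⊤) {c : K} (hc : C c ∈ A) : c ∈ V := by
  by_contra hcV
  obtain ⟨ε, u, hε, hu, hu', hu0, rfl⟩ := h.not_mem hcV
  refine hA' (eq_top_of_C_inv_mem h hA hε ?_)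
  have := A.mul_mem hc ((polynomialSubring_le_iff.1 hA).1 _ hu')
  rwa [← C_mul, mul_assoc, mul_inv_cancel₀ hu0, mul_one] at this

theorem C_inv_not_mem (h : IsMonomialFamily V τ) {A : Subring K[X]}
    (hA : polynomialSubring V ≤ A) (hA' : A ≠ ⊤) {ε : ℚ} (hε : 0 < ε) : C (τ ε)⁻¹ ∉ A :=
  fun hm => hA' (eq_top_of_C_inv_mem h hA hε hm)

theorem isMaximalSubring_of_forall_not_mem (h : IsMonomialFamily V τ) {A : Subring K[X]}
    (hA : polynomialSubring V ≤ A) (hA' : A ≠ ⊤)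
    (hB : ∀ f, f ∉ A → ∀ B : Subring K[X], A ≤ B → f ∈ B → ∃ ε > 0, C (τ ε)⁻¹ ∈ B) :
    IsMaximalSubring A := by
  refine ⟨hA', fun B hAB => ?_⟩
  by_cases hBA : B ≤ A
  · exact Or.inl (le_antisymm hBA hAB)
  · obtain ⟨f, hfB, hfA⟩ := SetLike.not_le_iff_exists.1 hBA
    obtain ⟨ε, hε, hm⟩ := hB f hfA B hAB hfB
    exact Or.inr (eq_top_of_C_inv_mem h (hA.trans hAB) hε hm)

/-- The form `d * (1 + t^δ b)` passes from linear factors to products, hence to all polynomials. For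
`f` outside `A` the constant `d` must lie outside `V`, and the error term can then be removed inside
any larger ring. -/
theorem isMaximalSubring_of_forall_linear [IsAlgClosed K] (h : IsMonomialFamily V τ)
    {A : Subring K[X]} (hA : polynomialSubring V ≤ A) (hA' : A ≠ ⊤)
    (hlin : ∀ c, ∃ d, ∃ δ > 0, ∃ b ∈ A, (X - C c : K[X]) = C d * (1 + C (τ δ) * b)) :
    IsMaximalSubring A := by
  have hC := (polynomialSubring_le_iff.1 hA).1
  have hall : ∀ f : K[X], ∃ d, ∃ δ > 0, ∃ b ∈ A, f = C d * (1 + C (τ δ) * b) := by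
    intro f
    induction f using induction_on_linear with
    | const c => exact ⟨c, 1, one_pos, 0, A.zero_mem, by simp⟩
    | linear c => exact hlin c
    | mul f g hf hg =>
      obtain ⟨d, δ, hδ, b, hb, rfl⟩ := hf
      obtain ⟨d', δ', hδ', b', hb', rfl⟩ := hg
      have e1 : τ δ = τ (min δ δ') * τ (δ - min δ δ') := by rw [← h.map_add]; congr 1; ring
      have e2 : τ δ' = τ (min δ δ') * τ (δ' - min δ δ') := by rw [← h.map_add]; congr 1; ring
      have m1 := hC _ ((h.mem_iff (δ - min δ δ')).2 (sub_nonneg.2 (min_le_left _ _)))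
      have m2 := hC _ ((h.mem_iff (δ' - min δ δ')).2 (sub_nonneg.2 (min_le_right _ _)))
      have m3 := hC _ ((h.mem_iff δ').2 hδ'.le)
      refine ⟨d * d', min δ δ', lt_min hδ hδ', C (τ (δ - min δ δ')) * b +
        C (τ (δ' - min δ δ')) * b' + C (τ (δ - min δ δ')) * b * (C (τ δ') * b'), ?_, ?_⟩
      · exact A.add_mem (A.add_mem (A.mul_mem m1 hb) (A.mul_mem m2 hb'))
          (A.mul_mem (A.mul_mem m1 hb) (A.mul_mem m3 hb'))
      · have e1' := congrArg (C : K →+* K[X]) e1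
        have e2' := congrArg (C : K →+* K[X]) e2
        rw [C_mul] at e1' e2'
        rw [C_mul]
        linear_combination (C d * C d') * (b * (1 + C (τ δ') * b')) * e1' + (C d * C d') * b' * e2'
  refine isMaximalSubring_of_forall_not_mem h hA hA' fun f hf B hAB hfB => ?_
  obtain ⟨d, δ, hδ, b, hb, rfl⟩ := hall f
  have hd : d ∉ V := by
    intro hd
    exact hf (A.mul_mem (hC _ hd) (A.add_mem A.one_mem
      (A.mul_mem (hC _ ((h.mem_iff _).2 hδ.le)) hb)))
  obtain ⟨ε, u, hε, hu, hu', hu0, rfl⟩ := h.not_mem hd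
  refine ⟨min ε δ, lt_min hε hδ, ?_⟩
  -- With `d = t^(-ε) u`, scaling `f` by `u⁻¹ t^(ε - min ε δ)` gives `t^(-min ε δ) + t^(δ - min ε δ)
  -- b`, whose second summand lies in `A`.
  have m1 := hAB (hC _ (V.mul_mem hu'
    ((h.mem_iff (ε - min ε δ)).2 (sub_nonneg.2 (min_le_left _ _)))))
  have m2 := hAB (A.mul_mem (hC _ ((h.mem_iff (δ - min ε δ)).2
    (sub_nonneg.2 (min_le_right _ _)))) hb)
  have := B.sub_mem (B.mul_mem m1 hfB) m2
  convert this using 1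
  have e1 : u⁻¹ * τ (ε - min ε δ) * ((τ ε)⁻¹ * u) = (τ (min ε δ))⁻¹ := by
    rw [← h.div_eq]
    field_simp [h.ne_zero ε, h.ne_zero (min ε δ), hu0]
  have e2 : (τ (min ε δ))⁻¹ * τ δ = τ (δ - min ε δ) := h.div_eq _ _
  rw [← mul_assoc, ← C_mul, e1, ← e2, C_mul]
  ring

/-! ### The rings `V + (y - b) K[y]` -/

theorem eval_mem_of_mem_pointSubring {b : K} {f : K[X]} (hf : f ∈ pointSubring V b) :
    f.eval b ∈ V := by
  obtain ⟨c, hc, g, rfl⟩ := hf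
  simpa using hc

theorem mem_pointSubring_iff {b : K} {f : K[X]} : f ∈ pointSubring V b ↔ f.eval b ∈ V := by
  refine ⟨eval_mem_of_mem_pointSubring, fun hf => ⟨_, hf, ?_⟩⟩
  obtain ⟨g, hg⟩ := X_sub_C_dvd_sub_C_eval (a := b) (p := f)
  exact ⟨g, by rw [← hg]; ring⟩

theorem polynomialSubring_le_pointSubring {b : K} (hb : b ∈ V) :
    polynomialSubring V ≤ pointSubring V b := by
  rw [polynomialSubring_le_iff]
  simp only [mem_pointSubring_iff, eval_C, eval_X]
  exact ⟨fun _ => id, hb⟩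

theorem pointSubring_ne_top (h : IsMonomialFamily V τ) (b : K) : pointSubring V b ≠ ⊤ := by
  intro ht
  have : C (τ (-1)) ∈ pointSubring V b := ht ▸ Subring.mem_top _
  rw [mem_pointSubring_iff, eval_C, h.mem_iff] at this
  linarith

theorem isMaximalSubring_pointSubring (h : IsMonomialFamily V τ) {b : K} (hb : b ∈ V) :
    IsMaximalSubring (pointSubring V b) := by
  refine isMaximalSubring_of_forall_not_mem h (polynomialSubring_le_pointSubring hb)
    (pointSubring_ne_top h b) fun f hf B hAB hfB => ?_
  rw [mem_pointSubring_iff] at hf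
  obtain ⟨ε, u, hε, hu, hu', hu0, hfu⟩ := h.not_mem hf
  refine ⟨ε, hε, ?_⟩
  have h1 : C (f.eval b) ∈ B := by
    have : f - C (f.eval b) ∈ B := hAB (by rw [mem_pointSubring_iff]; simp)
    simpa using B.sub_mem hfB this
  have h2 : C u⁻¹ ∈ B := hAB (by rw [mem_pointSubring_iff]; simpa using hu')
  have := B.mul_mem h1 h2
  rwa [hfu, ← C_mul, mul_assoc, mul_inv_cancel₀ hu0, mul_one] at this

theorem adjoinSubring_eq_pointSubring (h : IsMonomialFamily V τ) {b : K} (hb : b ∈ V)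
    {G : Set K[X]} (hG : ∀ g ∈ G, g.eval b ∈ V)
    (hs : ∀ s, C (τ s)⁻¹ * (X - C b) ∈ adjoinSubring V G) :
    adjoinSubring V G = pointSubring V b := by
  refine le_antisymm (adjoinSubring_le ?_ ?_) ?_
  · intro c hc
    simpa [mem_pointSubring_iff] using hc
  · intro g hg
    exact mem_pointSubring_iff.2 (hG g hg)
  · rintro _ ⟨c, hc, g, rfl⟩
    set A := adjoinSubring V G
    refine A.add_mem (C_mem_adjoinSubring G hc) ?_
    have hX : X ∈ A := by
      have := A.add_mem (hs 0) (C_mem_adjoinSubring G hb)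
      simpa [h.map_zero] using this
    induction g using Polynomial.induction_on' with
    | add p q hp hq => rw [mul_add]; exact A.add_mem hp hq
    | monomial n a =>
      rcases eq_or_ne a 0 with rfl | ha
      · simp
      obtain ⟨s, u, hu, -, -, rfl⟩ := h.exists_eq_mul a ha
      have := A.mul_mem (hs (-s)) (A.mul_mem (C_mem_adjoinSubring G hu) (A.pow_mem hX n))
      convert this using 1
      rw [← C_mul_X_pow_eq_monomial, h.map_neg, inv_inv, C_mul]
      ring

theorem pointSubring_injective (h : IsMonomialFamily V τ) {a b : K}
    (hab : pointSubring V a = pointSubring V b) : a = b := by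
  by_contra hne
  obtain ⟨s, u, hu, hu', hu0, hs⟩ := h.exists_eq_mul (b - a) (sub_ne_zero.2 (Ne.symm hne))
  -- As `s` is the valuation of `b - a`, this element takes at `b` a value of valuation `-1`.
  have h1 : C (τ (s + 1))⁻¹ * (X - C a) ∈ pointSubring V a := by
    simp [mem_pointSubring_iff]
  rw [hab, mem_pointSubring_iff, eval_mul, eval_C, eval_sub, eval_X, eval_C, hs, ← mul_assoc,
    h.div_eq, h.mul_mem_iff hu hu' hu0, h.mem_iff] at h1
  linarith

end Monomial

/-! ### Centers of maximal subrings -/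

section Centers

variable {K : Type*} [Field K] {V : Subring K} {τ : ℚ → K}

theorem C_inv_mul_mem_of_le (h : IsMonomialFamily V τ) {A : Subring K[X]}
    (hA : polynomialSubring V ≤ A) {f : K[X]} {s r : ℚ} (hsr : s ≤ r)
    (hf : C (τ r)⁻¹ * f ∈ A) : C (τ s)⁻¹ * f ∈ A := by
  have h1 : C (τ (r - s)) ∈ A :=
    (polynomialSubring_le_iff.1 hA).1 _ ((h.mem_iff _).2 (by linarith))
  have := A.mul_mem h1 hf
  rwa [← h.div_eq, ← mul_assoc, ← C_mul, mul_assoc, mul_inv_cancel₀ (h.ne_zero r), mul_one] at this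

theorem inv_mul_sub_mem (h : IsMonomialFamily V τ) {A : Subring K[X]}
    (hA : polynomialSubring V ≤ A) (hA' : A ≠ ⊤) {b c : K} {s : ℚ}
    (hb : C (τ s)⁻¹ * (X - C b) ∈ A) (hc : C (τ s)⁻¹ * (X - C c) ∈ A) :
    (τ s)⁻¹ * (b - c) ∈ V := by
  refine mem_of_C_mem h hA hA' ?_
  have := A.sub_mem hc hb
  rwa [← mul_sub, sub_sub_sub_cancel_left, ← C_sub, ← C_mul] at this

theorem mem_of_inv_mul_mem (h : IsMonomialFamily V τ) {A : Subring K[X]}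
    (hA : polynomialSubring V ≤ A) (hA' : A ≠ ⊤) {b : K} {s : ℚ} (hs : 0 ≤ s)
    (hb : C (τ s)⁻¹ * (X - C b) ∈ A) : b ∈ V := by
  have h1 := C_inv_mul_mem_of_le h hA hs hb
  have h2 : C (τ 0)⁻¹ * (X - C 0) ∈ A := by
    simpa [h.map_zero] using (polynomialSubring_le_iff.1 hA).2
  simpa [h.map_zero] using inv_mul_sub_mem h hA hA' h1 h2

/-- If a maximal subring `A` contains `(y - b) / tˢ` whenever it contains `(y - c) / tˢ` for
some `c`, then it contains `(y - b) / tˢ` for all `s`. -/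
theorem forall_inv_mul_mem_of_center [IsAlgClosed K] (h : IsMonomialFamily V τ)
    {A : Subring K[X]} (hA : polynomialSubring V ≤ A) (hmax : IsMaximalSubring A) {b : K}
    (hb : ∀ c s, C (τ s)⁻¹ * (X - C c) ∈ A → C (τ s)⁻¹ * (X - C b) ∈ A) (q : ℚ) :
    C (τ q)⁻¹ * (X - C b) ∈ A := by
  by_contra hq
  obtain ⟨hC, hX⟩ := polynomialSubring_le_iff.1 hA
  have hb0 : C (τ 0)⁻¹ * (X - C b) ∈ A := hb 0 0 (by simpa [h.map_zero] using hX)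
  have hbV : b ∈ V := mem_of_inv_mul_mem h hA hmax.1 le_rfl hb0
  have hq0 : 0 ≤ q := by
    by_contra hneg
    exact hq (C_inv_mul_mem_of_le h hA (not_le.1 hneg).le hb0)
  set z : K[X] := C (τ q)⁻¹ * (X - C b) with hz
  -- The contradiction comes from `A ≤ B`: the ring `B` contains `z ∉ A` but stays inside
  -- `pointSubring V b`, so it is neither `A` nor everything.
  set B := adjoinSubring V {z}
  have hzB : z ∈ B := subset_adjoinSubring V _ rfl
  have hXb : ∀ c : K, X - C c = C (τ q) * z + C (b - c) := by
    intro c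
    rw [hz, ← mul_assoc, ← C_mul, mul_inv_cancel₀ (h.ne_zero q), C_1, C_sub]
    ring
  have hBtop : B ≠ ⊤ := by
    intro ht
    have h1 : B ≤ pointSubring V b := by
      refine adjoinSubring_le ?_ ?_
      · intro c hc
        simpa [mem_pointSubring_iff] using hc
      · rintro _ rfl
        simp [mem_pointSubring_iff, hz]
    exact pointSubring_ne_top h b (top_le_iff.1 (ht ▸ h1))
  -- Each `f` is normalized to a `g ∈ B` that is not divisible in `A` by any `t^ε`. If `f ∈ A`, this
  -- forces `d ∈ V`, hence `f ∈ B`.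
  have hall : ∀ f : K[X], ∃ d, ∃ g ∈ B, f = C d * g ∧ ∀ ε > 0, C (τ ε)⁻¹ * g ∉ A := by
    intro f
    induction f using induction_on_linear with
    | const c =>
      exact ⟨c, 1, B.one_mem, by simp, fun ε hε => by
        simpa using C_inv_not_mem h hA hmax.1 hε⟩
    | linear c =>
      -- For `y - c` the right exponent `r` is the smaller of `q` and the valuation of `b - c`.
      have key : ∀ r : ℚ, r ≤ q → (τ r)⁻¹ * (b - c) ∈ V →
          (∀ ε > 0, C (τ ε)⁻¹ * (C (τ r)⁻¹ * (X - C c)) ∉ A) →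
          ∃ d, ∃ g ∈ B, X - C c = C d * g ∧ ∀ ε > 0, C (τ ε)⁻¹ * g ∉ A := by
        intro r hr hbc hε
        refine ⟨τ r, C (τ r)⁻¹ * (X - C c), ?_, ?_, hε⟩
        · rw [hXb, mul_add, ← mul_assoc, ← C_mul, ← C_mul, h.div_eq]
          exact B.add_mem (B.mul_mem (C_mem_adjoinSubring _ ((h.mem_iff _).2 (by linarith))) hzB)
            (C_mem_adjoinSubring _ hbc)
        · rw [← mul_assoc, ← C_mul, mul_inv_cancel₀ (h.ne_zero r), C_1, one_mul]
      have shift : ∀ ε r : ℚ, C (τ ε)⁻¹ * (C (τ r)⁻¹ * (X - C c)) ∈ A →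
          C (τ (r + ε))⁻¹ * (X - C c) ∈ A := by
        intro ε r hm
        rw [h.map_add, mul_inv, C_mul]
        convert hm using 1
        ring
      by_cases hcq : (τ q)⁻¹ * (b - c) ∈ V
      · refine key q le_rfl hcq fun ε hε hm => hq ?_
        exact C_inv_mul_mem_of_le h hA (by linarith) (hb _ _ (shift _ _ hm))
      · have hne : b - c ≠ 0 := by
          intro h0
          rw [h0, mul_zero] at hcq
          exact hcq V.zero_mem
        obtain ⟨e, u, hu, hu', hu0, he⟩ := h.exists_eq_mul _ hne
        rw [he, ← mul_assoc, h.div_eq, h.mul_mem_iff hu hu' hu0, h.mem_iff, not_le] at hcq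
        refine key e (by linarith) ?_ fun ε hε hm => ?_
        · rw [he, inv_mul_cancel_left₀ (h.ne_zero e)]
          exact hu
        · have h1 := shift _ _ hm
          have h2 := inv_mul_sub_mem h hA hmax.1 (hb _ _ h1) h1
          rw [he, ← mul_assoc, h.div_eq, h.mul_mem_iff hu hu' hu0, h.mem_iff] at h2
          linarith
    | mul f g hf hg =>
      obtain ⟨d, f, hf, rfl, hf'⟩ := hf
      obtain ⟨e, g, hg, rfl, hg'⟩ := hg
      refine ⟨d * e, f * g, B.mul_mem hf hg, by rw [C_mul]; ring, fun ε hε hm => ?_⟩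
      have ht : (C (τ 1) : K[X]) * C (τ 1)⁻¹ = 1 := by
        rw [← C_mul, mul_inv_cancel₀ (h.ne_zero 1), C_1]
      have hprod : (C (τ (ε / 2))⁻¹ * f) * (C (τ (ε / 2))⁻¹ * g) ∈ A := by
        convert hm using 1
        have : τ ε = τ (ε / 2) * τ (ε / 2) := by rw [← h.map_add, add_halves]
        rw [this, mul_inv, C_mul]
        ring
      rcases hmax.mem_or_mem_of_mul_mem (hC _ ((h.mem_iff 1).2 zero_le_one)) ht
        (C_inv_not_mem h hA hmax.1 one_pos) hprod with h1 | h1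
      · exact hf' _ (half_pos hε) h1
      · exact hg' _ (half_pos hε) h1
  have hAB : A ≤ B := by
    intro f hf
    obtain ⟨d, g, hg, rfl, hg'⟩ := hall f
    by_cases hd : d ∈ V
    · exact B.mul_mem (C_mem_adjoinSubring _ hd) hg
    · obtain ⟨ε, u, hε, hu, hu', hu0, rfl⟩ := h.not_mem hd
      refine absurd ?_ (hg' ε hε)
      have := A.mul_mem (hC _ hu') hf
      rwa [← mul_assoc, ← C_mul, mul_comm u⁻¹, mul_assoc, mul_inv_cancel₀ hu0, mul_one] at this
  rcases hmax.2 B hAB with hB | hB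
  · exact hq (hB ▸ hzB)
  · exact hBtop hB

/-- A maximal subring containing `V[y]` contains all `(y - b) / tˢ` for some `b`, or it contains
`(y - bᵢ) / t^{sᵢ}` for a sequence `bᵢ` that has no limit. -/
theorem exists_center_or_sequence [IsAlgClosed K] (h : IsMonomialFamily V τ)
    {A : Subring K[X]} (hA : polynomialSubring V ≤ A) (hmax : IsMaximalSubring A) :
    (∃ b ∈ V, ∀ s, C (τ s)⁻¹ * (X - C b) ∈ A) ∨
    ∃ (s : ℕ → ℚ) (b : ℕ → K), (∀ i, 0 ≤ s i) ∧ StrictMono s ∧ (∀ i, b i ∈ V) ∧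
      (∀ i, C (τ (s i))⁻¹ * (X - C (b i)) ∈ A) ∧
      ∀ c, ∃ i, C (τ (s i))⁻¹ * (X - C c) ∉ A := by
  by_cases hcen : ∃ b, ∀ s, C (τ s)⁻¹ * (X - C b) ∈ A
  · obtain ⟨b, hb⟩ := hcen
    exact Or.inl ⟨b, mem_of_inv_mul_mem h hA hmax.1 le_rfl (hb 0), hb⟩
  right
  push Not at hcen
  -- Without a center of all orders, every center is beaten by another one at some order.
  have hstep : ∀ b, ∃ c s, C (τ s)⁻¹ * (X - C c) ∈ A ∧ C (τ s)⁻¹ * (X - C b) ∉ A := by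
    intro b
    by_contra! hcon
    obtain ⟨s, hs⟩ := hcen b
    exact hs (forall_inv_mul_mem_of_center h hA hmax hcon s)
  set E : Set ℚ := {s | 0 ≤ s ∧ ∃ b, C (τ s)⁻¹ * (X - C b) ∈ A}
  have : Nonempty E := ⟨⟨0, le_rfl, 0, by
    simpa [h.map_zero] using (polynomialSubring_le_iff.1 hA).2⟩⟩
  have : NoMaxOrder E := by
    refine ⟨fun ⟨s, hs, b, hb⟩ => ?_⟩
    obtain ⟨c, r, hc, hr⟩ := hstep b
    have hsr : s < r := by
      by_contra hle
      exact hr (C_inv_mul_mem_of_le h hA (not_lt.1 hle) hb)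
    exact ⟨⟨r, hs.trans hsr.le, c, hc⟩, hsr⟩
  -- `E` is countable, so it has a cofinal sequence; having no maximum, it has a strictly increasing
  -- one.
  obtain ⟨u, -, hu⟩ := exists_seq_monotone_tendsto_atTop_atTop E
  obtain ⟨φ, hφ, hmono⟩ := strictMono_subseq_of_tendsto_atTop hu
  have htend := hu.comp hφ.tendsto_atTop
  choose b hb using fun i => (u (φ i)).2.2
  refine ⟨fun i => u (φ i), b, fun i => (u (φ i)).2.1, fun i j hij => hmono hij,
    fun i => mem_of_inv_mul_mem h hA hmax.1 (u (φ i)).2.1 (hb i), hb, fun c => ?_⟩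
  obtain ⟨d, r, hd, hr⟩ := hstep c
  rcases le_total 0 r with hr0 | hr0
  · obtain ⟨i, hi⟩ := (htend.eventually_ge_atTop ⟨r, hr0, d, hd⟩).exists
    exact ⟨i, fun hm => hr (C_inv_mul_mem_of_le h hA hi hm)⟩
  · exact ⟨0, fun hm => hr (C_inv_mul_mem_of_le h hA (hr0.trans (u (φ 0)).2.1) hm)⟩

end Centers

/-! ### The Hahn field -/

section HahnBasics

variable {k : Type*} [Field k]

theorem mem_hahnPlus_iff_coeff {x : HahnField k} :
    x ∈ hahnPlus k ↔ ∀ u < 0, x.coeff u = 0 := by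
  rw [mem_hahnPlus, HahnSeries.addVal_apply]
  constructor
  · intro h u hu
    exact HahnSeries.coeff_eq_zero_of_lt_orderTop (lt_of_lt_of_le (by exact_mod_cast hu) h)
  · intro h
    rcases eq_or_ne x 0 with rfl | hx
    · simp
    rw [← HahnSeries.order_eq_orderTop_of_ne_zero hx]
    by_contra hlt
    rw [not_le] at hlt
    exact HahnSeries.coeff_order_eq_zero.not.2 hx (h _ (by exact_mod_cast hlt))

theorem single_add_eq_mul (s r : ℚ) :
    (HahnSeries.single (s + r) 1 : HahnField k) =
      HahnSeries.single s 1 * HahnSeries.single r 1 := by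
  rw [HahnSeries.single_mul_single, one_mul]

theorem single_inv (s : ℚ) :
    (HahnSeries.single s 1 : HahnField k)⁻¹ = HahnSeries.single (-s) 1 := by
  symm
  refine eq_inv_of_mul_eq_one_left ?_
  rw [← single_add_eq_mul, neg_add_cancel]
  rfl

theorem inv_single_mul_mem_iff {x : HahnField k} {s : ℚ} :
    (HahnSeries.single s 1 : HahnField k)⁻¹ * x ∈ hahnPlus k ↔ ∀ u < s, x.coeff u = 0 := by
  rw [mem_hahnPlus_iff_coeff, single_inv]
  simp only [HahnSeries.coeff_single_mul, one_mul]
  constructor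
  · intro h u hu
    have := h (u - s) (by linarith)
    rwa [sub_neg_eq_add, sub_add_cancel] at this
  · intro h u hu
    exact h _ (by linarith)

theorem inv_mem_hahnPlus {x : HahnField k} (hx : x ∈ hahnPlus k) (hx0 : x.coeff 0 ≠ 0) :
    x⁻¹ ∈ hahnPlus k := by
  have hne : x ≠ 0 := by
    rintro rfl
    simp at hx0
  rw [mem_hahnPlus] at hx ⊢
  have h0 : HahnSeries.addVal ℚ k x ≤ 0 := HahnSeries.addVal_le_of_coeff_ne_zero hx0
  have h3 : HahnSeries.addVal ℚ k (x * x⁻¹) = 0 := by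
    rw [mul_inv_cancel₀ hne]
    simp
  rw [AddValuation.map_mul, le_antisymm h0 hx, zero_add] at h3
  exact h3.ge

/-- Stated for an embedding so that it serves both a subfield `K` and, with the identity, the Hahn
field itself. -/
theorem isMonomialFamily_comap {K : Type*} [Field K] (j : K →+* HahnField k) {τ : ℚ → K}
    (hτ : ∀ s, j (τ s) = HahnSeries.single s 1) :
    IsMonomialFamily ((hahnPlus k).comap j) τ where
  map_zero := j.injective ((hτ 0).trans (map_one j).symm)
  map_add s r := j.injective (by rw [map_mul, hτ, hτ, hτ, single_add_eq_mul])
  mem_iff s := by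
    rw [Subring.mem_comap, hτ, mem_hahnPlus, HahnSeries.addVal_apply,
      HahnSeries.orderTop_single one_ne_zero]
    exact_mod_cast Iff.rfl
  exists_eq_mul x hx := by
    have hjx : j x ≠ 0 := (_root_.map_ne_zero j).2 hx
    have hτ0 : τ (j x).order ≠ 0 := by
      intro h0
      have := hτ (j x).order
      rw [h0, map_zero] at this
      exact HahnSeries.single_ne_zero one_ne_zero this.symm
    have hmem : j ((τ (j x).order)⁻¹ * x) ∈ hahnPlus k := by
      rw [map_mul, map_inv₀, hτ, inv_single_mul_mem_iff]
      exact fun u hu => HahnSeries.coeff_eq_zero_of_lt_order hu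
    refine ⟨(j x).order, (τ (j x).order)⁻¹ * x, hmem, ?_, mul_ne_zero (inv_ne_zero hτ0) hx, ?_⟩
    · rw [Subring.mem_comap, map_inv₀]
      refine inv_mem_hahnPlus hmem ?_
      rw [map_mul, map_inv₀, hτ, single_inv, HahnSeries.coeff_single_mul, one_mul, zero_sub,
        neg_neg]
      exact HahnSeries.coeff_order_eq_zero.not.2 hjx
    · rw [mul_inv_cancel_left₀ hτ0]

theorem isMonomialFamily_single :
    IsMonomialFamily (hahnPlus k) (fun s => (HahnSeries.single s 1 : HahnField k)) :=
  isMonomialFamily_comap (RingHom.id _) fun _ => rfl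

/-- Hahn series that agree below given bounds have a common extension. -/
theorem exists_coeff_eq_of_compatible (T : Set (ℚ × HahnField k))
    (hT : ∀ p ∈ T, ∀ q ∈ T, p.1 ≤ q.1 → ∀ u < p.1, p.2.coeff u = q.2.coeff u) :
    ∃ x : HahnField k, ∀ p ∈ T, ∀ u < p.1, x.coeff u = p.2.coeff u := by
  classical
  let c : ℚ → k := fun u => if h : ∃ p ∈ T, u < p.1 then h.choose.2.coeff u else 0
  have hc : ∀ p ∈ T, ∀ u < p.1, c u = p.2.coeff u := by
    intro p hp u hu
    have h : ∃ p ∈ T, u < p.1 := ⟨p, hp, hu⟩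
    have hcu : c u = h.choose.2.coeff u := dif_pos h
    obtain ⟨hq, hqu⟩ := h.choose_spec
    rw [hcu]
    rcases le_total p.1 h.choose.1 with hle | hle
    · exact (hT p hp _ hq hle u hu).symm
    · exact hT _ hq p hp hle u hqu
  -- A descending sequence in the support stays below the bound of the piece containing its first
  -- term, so it would descend in the support of that single series.
  have hpwo : (Function.support c).IsPWO := by
    refine Set.IsWF.isPWO (Set.isWF_iff_no_descending_seq.2 fun f hf hfc => ?_)
    have h0 : ∃ p ∈ T, f 0 < p.1 := by
      by_contra hcon
      exact hfc 0 (dif_neg hcon)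
    obtain ⟨p, hp, hp0⟩ := h0
    refine Set.isWF_iff_no_descending_seq.1 p.2.isWF_support f hf fun n => ?_
    have hn : f n < p.1 := lt_of_le_of_lt (hf.antitone n.zero_le) hp0
    have := hfc n
    rwa [Function.mem_support, hc p hp _ hn] at this
  exact ⟨⟨c, hpwo⟩, hc⟩

end HahnBasics

/-! ### The Hahn field is algebraically closed -/

section HahnAlgClosed

variable {k : Type*} [Field k] {L : Type*} [Field L] [Algebra (HahnField k) L]

/-- `t` is not a unit of `k[[t^ℚ]]⁺`, so some valuation ring of `L` contains the image of that ring
and has `t` among its nonunits. -/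
theorem exists_valuationSubring_hahn (k : Type*) [Field k] (L : Type*) [Field L]
    [Algebra (HahnField k) L] : ∃ O : ValuationSubring L,
      (∀ x ∈ hahnPlus k, O.valuation (algebraMap _ L x) ≤ 1) ∧
      O.valuation (algebraMap _ L (HahnSeries.single (1 : ℚ) (1 : k))) < 1 := by
  have h := isMonomialFamily_single (k := k)
  set A : Subring L := (hahnPlus k).map (algebraMap (HahnField k) L)
  have ht : algebraMap _ L (HahnSeries.single (1 : ℚ) (1 : k)) ∈ A :=
    ⟨_, (h.mem_iff 1).2 zero_le_one, rfl⟩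
  obtain ⟨O, hO, hI⟩ := Ideal.image_subset_nonunits_valuationSubring
    (Ideal.span {(⟨_, ht⟩ : A)}) (by
      intro htop
      obtain ⟨⟨_, x, hx, rfl⟩, hax⟩ := Ideal.mem_span_singleton'.1
        ((Ideal.eq_top_iff_one _).1 htop)
      have h1 : x * HahnSeries.single (1 : ℚ) (1 : k) = 1 :=
        (algebraMap (HahnField k) L).injective (by
          rw [map_mul, map_one (algebraMap (HahnField k) L)]; exact congrArg Subtype.val hax)
      rw [eq_inv_of_mul_eq_one_left h1] at hx
      have := (h.mem_iff (-1)).1 (by rw [h.map_neg]; exact hx)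
      linarith)
  refine ⟨O, fun x hx => (O.valuation_le_one_iff _).2 (hO ⟨x, hx, rfl⟩), ?_⟩
  exact O.mem_nonunits_iff.1 (hI ⟨_, Ideal.subset_span rfl, rfl⟩)

variable {Γ : Type*} [LinearOrderedCommGroupWithZero Γ] {v : Valuation L Γ}

/-- The value of `tˢ`. -/
noncomputable def monomialValue (k : Type*) [Field k] {L : Type*} [Field L]
    [Algebra (HahnField k) L] {Γ : Type*} [LinearOrderedCommGroupWithZero Γ] (v : Valuation L Γ)
    (s : ℚ) : Γ :=
  v (algebraMap (HahnField k) L (HahnSeries.single s 1))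

theorem monomialValue_add (s r : ℚ) :
    monomialValue k v (s + r) = monomialValue k v s * monomialValue k v r := by
  rw [monomialValue, single_add_eq_mul, map_mul, map_mul]
  rfl

theorem monomialValue_zero : monomialValue k v 0 = 1 := by
  rw [monomialValue, HahnSeries.single_zero_one, map_one, map_one]

theorem monomialValue_ne_zero (s : ℚ) : monomialValue k v s ≠ 0 := by
  rw [monomialValue, Valuation.ne_zero_iff, _root_.map_ne_zero]
  exact HahnSeries.single_ne_zero one_ne_zero

theorem monomialValue_nsmul (n : ℕ) (s : ℚ) :
    monomialValue k v (n * s) = monomialValue k v s ^ n := by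
  rw [monomialValue, isMonomialFamily_single.map_nsmul, map_pow, map_pow]
  rfl

/-- The valuation `v` of the extension `L` of the Hahn field dominates the Hahn valuation. -/
structure DominatesHahn (k : Type*) [Field k] {L : Type*} [Field L]
    [Algebra (HahnField k) L] {Γ : Type*} [LinearOrderedCommGroupWithZero Γ]
    (v : Valuation L Γ) : Prop where
  le_one : ∀ x ∈ hahnPlus k, v (algebraMap _ L x) ≤ 1
  single_lt_one : v (algebraMap _ L (HahnSeries.single (1 : ℚ) (1 : k))) < 1

namespace DominatesHahn

theorem monomialValue_lt_one (h : DominatesHahn k v) {s : ℚ} (hs : 0 < s) :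
    monomialValue k v s < 1 := by
  have hle : ∀ r : ℚ, 0 ≤ r → monomialValue k v r ≤ 1 := fun r hr =>
    h.le_one _ ((isMonomialFamily_single.mem_iff r).2 hr)
  refine lt_of_le_of_ne (hle s hs.le) fun h1 => ?_
  obtain ⟨n, hn⟩ := exists_nat_ge (1 / s)
  rw [div_le_iff₀ hs] at hn
  have h2 := monomialValue_nsmul (k := k) (v := v) n s
  rw [h1, one_pow, show (n : ℚ) * s = 1 + (n * s - 1) by ring, monomialValue_add] at h2
  have h3 : monomialValue k v 1 * monomialValue k v (n * s - 1) ≤ monomialValue k v 1 :=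
    mul_le_of_le_one_right' (hle _ (by linarith))
  rw [h2] at h3
  exact absurd h.single_lt_one (not_lt.2 h3)

theorem monomialValue_lt (h : DominatesHahn k v) {s r : ℚ} (hsr : s < r) :
    monomialValue k v r < monomialValue k v s := by
  rw [show r = s + (r - s) by ring, monomialValue_add]
  exact mul_lt_of_lt_one_right (zero_lt_iff.2 (monomialValue_ne_zero s))
    (h.monomialValue_lt_one (sub_pos.2 hsr))

theorem monomialValue_strictAnti (h : DominatesHahn k v) : StrictAnti (monomialValue k v) :=
  fun _ _ => h.monomialValue_lt

theorem exists_eq_monomialValue (h : DominatesHahn k v) {x : HahnField k} (hx : x ≠ 0) :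
    v (algebraMap _ L x) = monomialValue k v x.order := by
  have hu : ∀ y : HahnField k, y ∈ hahnPlus k → y⁻¹ ∈ hahnPlus k → y ≠ 0 →
      v (algebraMap _ L y) = 1 := by
    intro y hy hy' hy0
    refine le_antisymm (h.le_one _ hy) ?_
    have := h.le_one _ hy'
    rw [map_inv₀, map_inv₀] at this
    rwa [inv_le_one₀ (zero_lt_iff.2 ((Valuation.ne_zero_iff _).2 ((_root_.map_ne_zero _).2 hy0)))] at this
  have hs : (HahnSeries.single x.order 1 : HahnField k) ≠ 0 :=
    HahnSeries.single_ne_zero one_ne_zero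
  have hmem : (HahnSeries.single x.order 1 : HahnField k)⁻¹ * x ∈ hahnPlus k :=
    inv_single_mul_mem_iff.2 fun u hu => HahnSeries.coeff_eq_zero_of_lt_order hu
  have h1 := hu _ hmem (inv_mem_hahnPlus hmem (by
    rw [single_inv, HahnSeries.coeff_single_mul, one_mul, zero_sub, neg_neg]
    exact HahnSeries.coeff_order_eq_zero.not.2 hx)) (mul_ne_zero (inv_ne_zero hs) hx)
  conv_lhs => rw [← mul_inv_cancel_left₀ hs x, map_mul, map_mul, h1, mul_one]
  rfl

theorem le_monomialValue_iff (h : DominatesHahn k v) {x : HahnField k} {s : ℚ} :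
    v (algebraMap _ L x) ≤ monomialValue k v s ↔ ∀ u < s, x.coeff u = 0 := by
  rcases eq_or_ne x 0 with rfl | hx
  · simp
  rw [h.exists_eq_monomialValue hx, h.monomialValue_strictAnti.le_iff_ge]
  constructor
  · exact fun hs u hu => HahnSeries.coeff_eq_zero_of_lt_order (hu.trans_le hs)
  · intro hs
    by_contra hlt
    exact HahnSeries.coeff_order_eq_zero.not.2 hx (hs _ (not_le.1 hlt))

/-- The value group does not grow in algebraic extensions. -/
theorem exists_monomialValue_eq (h : DominatesHahn k v) [Algebra.IsAlgebraic (HahnField k) L]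
    {x : L} (hx : x ≠ 0) : ∃ s, v x = monomialValue k v s := by
  obtain ⟨p, hp0, hp⟩ := Algebra.IsAlgebraic.isAlgebraic (R := HahnField k) x
  have hvx : v x ≠ 0 := (Valuation.ne_zero_iff _).2 hx
  set w : ℕ → L := fun i => algebraMap _ L (p.coeff i) * x ^ i
  have hw0 : ∀ i ∈ p.support, v (w i) ≠ 0 := fun i hi => (Valuation.ne_zero_iff _).2
    (mul_ne_zero ((_root_.map_ne_zero _).2 (mem_support_iff.1 hi)) (pow_ne_zero _ hx))
  -- In the vanishing sum `p(x)`, the largest value is attained by two terms. Comparing them gives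
  -- `v x ^ (j - i)` as a monomial value, and exponents in `ℚ` can be divided by `j - i`.
  obtain ⟨i, hi, hmax⟩ := p.support.exists_max_image (fun i => v (w i))
    (support_nonempty.2 hp0)
  have hsum : ∑ j ∈ p.support, w j = 0 := by
    rw [← hp, aeval_def, eval₂_eq_sum, Polynomial.sum]
  have hex : ∃ j ∈ p.support, j ≠ i ∧ v (w j) = v (w i) := by
    by_contra! hcon
    have hlt : v (∑ j ∈ p.support.erase i, w j) < v (w i) :=
      v.map_sum_lt (hw0 i hi) fun j hj =>
        lt_of_le_of_ne (hmax j (Finset.mem_of_mem_erase hj))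
          (hcon j (Finset.mem_of_mem_erase hj) (Finset.ne_of_mem_erase hj))
    have := v.map_add_eq_of_lt_left hlt
    rw [Finset.add_sum_erase _ _ hi, hsum, map_zero] at this
    exact hw0 i hi this.symm
  have hsolve : ∀ i ∈ p.support, ∀ j ∈ p.support, i < j → v (w i) = v (w j) →
      ∃ s, v x = monomialValue k v s := by
    intro i hi j hj hij he
    simp only [w, map_mul, map_pow, h.exists_eq_monomialValue (mem_support_iff.1 hi),
      h.exists_eq_monomialValue (mem_support_iff.1 hj)] at he
    set a := (p.coeff i).order
    set b := (p.coeff j).order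
    have hn : ((j - i : ℕ) : ℚ) ≠ 0 := by
      have : j - i ≠ 0 := by omega
      exact_mod_cast this
    refine ⟨(a - b) / (j - i : ℕ), ?_⟩
    rw [← pow_left_inj₀ zero_le zero_le (show j - i ≠ 0 by omega), ← monomialValue_nsmul,
      mul_div_cancel₀ _ hn]
    have h1 : monomialValue k v a = monomialValue k v b * monomialValue k v (a - b) := by
      rw [← monomialValue_add]
      congr 1
      ring
    have h2 : v x ^ j = v x ^ (j - i) * v x ^ i := by rw [← pow_add]; congr 1; omega
    rw [h1, h2, mul_assoc] at he
    have h3 := mul_left_cancel₀ (monomialValue_ne_zero b) he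
    exact (mul_right_cancel₀ (pow_ne_zero i hvx) h3).symm
  obtain ⟨j, hj, hji, he⟩ := hex
  rcases lt_or_gt_of_ne hji with hlt | hlt
  · exact hsolve j hj i hi hlt he
  · exact hsolve i hi j hj hlt he.symm

theorem constant_eq_one (h : DominatesHahn k v) {c : k} (hc : c ≠ 0) :
    v (algebraMap (HahnField k) L (HahnSeries.C c)) = 1 := by
  rw [h.exists_eq_monomialValue (HahnSeries.C_ne_zero hc), HahnSeries.order_C, monomialValue_zero]

/-- The residue field does not grow in algebraic extensions. -/
theorem exists_sub_constant_lt_one (h : DominatesHahn k v) [IsAlgClosed k]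
    [Algebra.IsAlgebraic (HahnField k) L] {x : L} (hx : v x = 1) :
    ∃ c : k, v (x - algebraMap (HahnField k) L (HahnSeries.C c)) < 1 := by
  obtain ⟨p, hp0, hp⟩ := Algebra.IsAlgebraic.isAlgebraic (R := HahnField k) x
  obtain ⟨i, hi, hmin⟩ := p.support.exists_min_image (fun i => (p.coeff i).order)
    (support_nonempty.2 hp0)
  set m := (p.coeff i).order
  let ι : k →+* L := (algebraMap (HahnField k) L).comp HahnSeries.C
  -- The reduction of `t^(-m) p` to the residue field; minimality of `m` makes it well defined and
  -- nonzero.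
  let q : k[X] := ∑ j ∈ p.support, monomial j ((p.coeff j).coeff m)
  have hq0 : q ≠ 0 := by
    intro h0
    have := congrArg (fun f : k[X] => f.coeff i) h0
    simp only [q, finsetSum_coeff, coeff_monomial, coeff_zero, Finset.sum_ite_eq', hi,
      if_true] at this
    exact HahnSeries.coeff_order_eq_zero.not.2 (mem_support_iff.1 hi) this
  have hq : v (eval₂ ι x q) < 1 := by
    have hsum : ∑ j ∈ p.support,
        algebraMap _ L ((HahnSeries.single m 1)⁻¹ * p.coeff j) * x ^ j = 0 := by
      have h1 : ∑ j ∈ p.support, algebraMap _ L (p.coeff j) * x ^ j = 0 := by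
        rw [← hp, aeval_def, eval₂_eq_sum, Polynomial.sum]
      simp only [map_mul, mul_assoc]
      rw [← Finset.mul_sum, h1, mul_zero]
    have h2 : eval₂ ι x q = ∑ j ∈ p.support, algebraMap _ L
        (HahnSeries.C ((p.coeff j).coeff m) - (HahnSeries.single m 1)⁻¹ * p.coeff j) * x ^ j := by
      simp only [map_sub, sub_mul, Finset.sum_sub_distrib]
      rw [hsum, sub_zero]
      simp only [q, eval₂_finsetSum, eval₂_monomial]
      rfl
    rw [h2]
    refine v.map_sum_lt one_ne_zero fun j hj => ?_
    rw [map_mul, map_pow, hx, one_pow, mul_one]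
    set y := HahnSeries.C ((p.coeff j).coeff m) - (HahnSeries.single m 1)⁻¹ * p.coeff j with hy
    have hcoef : ∀ u ≤ 0, y.coeff u = 0 := by
      intro u hu
      rw [hy, single_inv, HahnSeries.coeff_sub, HahnSeries.coeff_single_mul, one_mul,
        sub_neg_eq_add, HahnSeries.C_apply]
      rcases eq_or_lt_of_le hu with rfl | hu
      · simp
      · rw [HahnSeries.coeff_single_of_ne hu.ne, HahnSeries.coeff_eq_zero_of_lt_order, sub_zero]
        exact lt_of_lt_of_le (by linarith) (hmin j hj)
    rcases eq_or_ne y 0 with h0 | h0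
    · rw [h0, map_zero, map_zero]
      exact zero_lt_one
    · rw [h.exists_eq_monomialValue h0]
      refine h.monomialValue_lt_one ?_
      by_contra hle
      exact HahnSeries.coeff_order_eq_zero.not.2 h0 (hcoef _ (not_lt.1 hle))
  by_contra! hcon
  -- If no constant were close to `x`, every linear factor of `q` would have value at least `1` at
  -- `x`, against `v (q(x)) < 1`.
  have hall : ∀ f : k[X], f ≠ 0 → 1 ≤ v (eval₂ ι x f) := by
    intro f
    induction f using induction_on_linear with
    | const c =>
      intro hc
      rw [eval₂_C]
      exact (h.constant_eq_one (C_ne_zero.1 hc)).ge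
    | linear c =>
      intro _
      rw [eval₂_sub, eval₂_X, eval₂_C]
      exact hcon c
    | mul f g hf hg =>
      intro hfg
      rw [eval₂_mul, map_mul]
      exact one_le_mul (hf (left_ne_zero_of_mul hfg)) (hg (right_ne_zero_of_mul hfg))
  exact absurd hq (not_lt.2 (hall q hq0))

theorem exists_sub_single_lt (h : DominatesHahn k v) [IsAlgClosed k]
    [Algebra.IsAlgebraic (HahnField k) L] {x : L} (hx : x ≠ 0) :
    ∃ (s : ℚ) (c : k), v x = monomialValue k v s ∧
      v (x - algebraMap (HahnField k) L (HahnSeries.single s c)) < monomialValue k v s := by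
  obtain ⟨s, hs⟩ := h.exists_monomialValue_eq hx
  set t := algebraMap _ L (HahnSeries.single s 1 : HahnField k)
  have ht : t ≠ 0 := (_root_.map_ne_zero _).2 (HahnSeries.single_ne_zero one_ne_zero)
  have hvt : v t = monomialValue k v s := rfl
  have h1 : v (t⁻¹ * x) = 1 := by
    rw [map_mul, map_inv₀, hs, hvt, inv_mul_cancel₀ (monomialValue_ne_zero s)]
  obtain ⟨c, hc⟩ := h.exists_sub_constant_lt_one h1
  refine ⟨s, c, hs, ?_⟩
  have h2 : x - algebraMap (HahnField k) L (HahnSeries.single s c) =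
      t * (t⁻¹ * x - algebraMap (HahnField k) L (HahnSeries.C c)) := by
    rw [mul_sub, mul_inv_cancel_left₀ ht, ← map_mul, HahnSeries.C_apply,
      HahnSeries.single_mul_single, add_zero, one_mul]
  rw [h2, map_mul, hvt]
  exact mul_lt_of_lt_one_right (zero_lt_iff.2 (monomialValue_ne_zero s)) hc

/-- The Hahn field has no proper algebraic extensions. -/
theorem algebraMap_surjective (h : DominatesHahn k v) [IsAlgClosed k]
    [Algebra.IsAlgebraic (HahnField k) L] :
    Function.Surjective (algebraMap (HahnField k) L) := by
  intro z
  -- All approximations of `z`, each with a guaranteed order; two of them agree below the smaller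
  -- order, so they glue to a series `x`.
  let T : Set (ℚ × HahnField k) := {p | v (z - algebraMap _ L p.2) ≤ monomialValue k v p.1}
  obtain ⟨x, hx⟩ := exists_coeff_eq_of_compatible T (by
    intro p hp q hq hpq u hu
    have h1 : v (algebraMap _ L (p.2 - q.2)) ≤ monomialValue k v p.1 := by
      rw [map_sub, ← sub_sub_sub_cancel_left _ _ z]
      exact v.map_sub_le (hq.trans (h.monomialValue_strictAnti.antitone hpq)) hp
    have := h.le_monomialValue_iff.1 h1 u hu
    rwa [HahnSeries.coeff_sub, sub_eq_zero] at this)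
  refine ⟨x, ?_⟩
  by_contra hne
  obtain ⟨s, c, hs, hc⟩ := h.exists_sub_single_lt (sub_ne_zero.2 (Ne.symm hne))
  have hc0 : c ≠ 0 := by
    rintro rfl
    rw [HahnSeries.single_eq_zero, map_zero, sub_zero, hs] at hc
    exact lt_irrefl _ hc
  rw [sub_sub, ← map_add] at hc
  -- Adding the leading term of `z - x` gives an approximation of order beyond `s`. By gluing it
  -- agrees with `x` at `s`, although the two differ there by `c ≠ 0`.
  have hT : ∃ r > s, (r, x + HahnSeries.single s c) ∈ T := by
    by_cases h0 : z - algebraMap _ L (x + HahnSeries.single s c) = 0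
    · refine ⟨s + 1, by simp, ?_⟩
      change v _ ≤ _
      rw [h0, map_zero]
      exact zero_le
    · obtain ⟨r, hr⟩ := h.exists_monomialValue_eq h0
      refine ⟨r, ?_, hr.le⟩
      rw [hr, h.monomialValue_strictAnti.lt_iff_gt] at hc
      exact hc
  obtain ⟨r, hr, hmem⟩ := hT
  have := hx _ hmem s hr
  simp [hc0] at this

end DominatesHahn

end HahnAlgClosed

instance isAlgClosed_hahnField (k : Type*) [Field k] [IsAlgClosed k] :
    IsAlgClosed (HahnField k) := by
  obtain ⟨O, hO, hO'⟩ := exists_valuationSubring_hahn k (AlgebraicClosure (HahnField k))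
  have hsurj := (DominatesHahn.mk hO hO').algebraMap_surjective
  refine IsAlgClosed.of_exists_root _ fun p _ hp => ?_
  obtain ⟨y, hy⟩ := IsAlgClosed.exists_aeval_eq_zero (AlgebraicClosure (HahnField k)) p
    hp.degree_pos.ne'
  obtain ⟨x, rfl⟩ := hsurj y
  refine ⟨x, (algebraMap _ (AlgebraicClosure (HahnField k))).injective ?_⟩
  rw [map_zero, ← hy, aeval_algebraMap_apply, coe_aeval_eq_eval]

/-! ### Admissible pairs -/

section Pairs

variable {k : Type*} [Field k] {K : Subfield (HahnField k)}

theorem mem_plus_iff {x : K} : x ∈ plus K ↔ ∀ u < 0, (x : HahnField k).coeff u = 0 :=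
  mem_hahnPlus_iff_coeff

theorem HasCutoffProperty.exists_truncation (h : HasCutoffProperty K) (a : K) (u : ℚ) :
    ∃ b : K, ∀ s, (b : HahnField k).coeff s = if s < u then (a : HahnField k).coeff s else 0 := by
  obtain ⟨b, hb, hbc⟩ := h a a.2 u
  refine ⟨a - ⟨b, hb⟩, fun s => ?_⟩
  rw [Subfield.coe_sub, HahnSeries.coeff_sub, hbc]
  split_ifs with h1 h2 h2
  · linarith
  · rw [sub_self]
  · rw [sub_zero]
  · linarith

theorem isLimitOfPair_iff {s : ℕ → ℚ} {a : ℕ → K} {b : K} :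
    IsLimitOfPair K s a b ↔
      ∀ i, ∀ u < s i, ((b : HahnField k) - (a i : HahnField k)).coeff u = 0 := by
  refine forall_congr' fun i => ⟨fun h u hu => ?_, fun h u hu => ?_⟩
  · by_contra hne
    exact absurd (h hne) (not_le.2 hu)
  · by_contra hlt
    exact hu (h u (not_le.1 hlt))

theorem IsAdmissiblePair.coeff_sub_eq_zero {s : ℕ → ℚ} {a : ℕ → K} (h : IsAdmissiblePair K s a)
    {i l : ℕ} (hil : i ≤ l) {u : ℚ} (hu : u < s i) :
    ((a l : HahnField k) - (a i : HahnField k)).coeff u = 0 := by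
  induction l, hil using Nat.le_induction with
  | base => simp
  | succ l hl ih =>
    have h1 : ((a (l + 1) : HahnField k) - (a l : HahnField k)).coeff u = 0 := by
      by_contra hne
      exact absurd (h.support_sub_subset l hne).1
        (not_le.2 (hu.trans_le (h.strictMono.monotone hl)))
    rw [HahnSeries.coeff_sub] at *
    rw [← sub_add_sub_cancel _ ((a l : HahnField k).coeff u), h1, ih, add_zero]

theorem IsAdmissiblePair.mem_plus {s : ℕ → ℚ} {a : ℕ → K} (h : IsAdmissiblePair K s a) (i : ℕ) :
    a i ∈ plus K := by
  rw [mem_plus_iff]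
  intro u hu
  by_contra hne
  exact absurd (h.support_subset i hne).1 (not_le.2 hu)

/-- Truncations of a pseudo-convergent sequence form an admissible pair. -/
theorem HasCutoffProperty.exists_isAdmissiblePair (h : HasCutoffProperty K) {s : ℕ → ℚ}
    {b : ℕ → K} (hs : ∀ i, 0 ≤ s i) (hmono : StrictMono s) (hb : ∀ i, b i ∈ plus K)
    (hbs : ∀ i, ∀ u < s i, (b (i + 1) : HahnField k).coeff u = (b i : HahnField k).coeff u) :
    ∃ a : ℕ → K, IsAdmissiblePair K s a ∧
      ∀ i, ∀ u < s i, (a i : HahnField k).coeff u = (b i : HahnField k).coeff u := by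
  choose a ha using fun i => h.exists_truncation (b i) (s i)
  refine ⟨a, ⟨hs, hmono, fun i u hu => ?_, fun i u hu => ?_⟩, fun i u hu => by
    rw [ha, if_pos hu]⟩
  · rw [HahnSeries.mem_support, ha] at hu
    split_ifs at hu with hlt
    · refine ⟨?_, hlt⟩
      by_contra hneg
      exact hu (mem_plus_iff.1 (hb i) u (not_le.1 hneg))
    · exact absurd rfl hu
  · rw [HahnSeries.mem_support, HahnSeries.coeff_sub, ha, ha] at hu
    constructor
    · by_contra hlt
      rw [not_le] at hlt
      rw [if_pos hlt, if_pos (hlt.trans (hmono (Nat.lt_succ_self i))), hbs i u hlt,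
        sub_self] at hu
      exact hu rfl
    · by_contra hlt
      rw [if_neg hlt, if_neg fun h' => hlt (h'.trans (hmono (Nat.lt_succ_self i))),
        sub_zero] at hu
      exact hu rfl

/-! ### The subrings attached to admissible pairs -/

section Subring

variable [IsAlgClosed K] {hK : rationalFunctions k ≤ K}

theorem isMonomialFamily_tPow : IsMonomialFamily (plus K) (tPow K hK) :=
  isMonomialFamily_comap K.subtype fun _ => rfl

theorem inv_tPow_mul_sub_mem_iff {x y : K} {s : ℚ} : (tPow K hK s)⁻¹ * (x - y) ∈ plus K ↔
    ∀ u < s, ((x : HahnField k) - (y : HahnField k)).coeff u = 0 :=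
  inv_single_mul_mem_iff

theorem generator_mem_pairSubring (s : ℕ → ℚ) (a : ℕ → K) (i : ℕ) :
    C (tPow K hK (s i))⁻¹ * (X - C (a i)) ∈ pairSubring K hK s a :=
  subset_adjoinSubring _ _ ⟨i, rfl⟩

/-- `(y - a) / tˢ` and `(y - b) / tˢ` lie in the same rings if `a` and `b` agree below `s`. -/
theorem inv_tPow_mul_mem_of_coeff_eq {A : Subring K[X]} (hA : ∀ c ∈ plus K, C c ∈ A) {s : ℚ}
    {a b : K} (hab : ∀ u < s, ((a : HahnField k) - (b : HahnField k)).coeff u = 0)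
    (ha : C (tPow K hK s)⁻¹ * (X - C a) ∈ A) : C (tPow K hK s)⁻¹ * (X - C b) ∈ A := by
  have := A.add_mem ha (hA _ ((inv_tPow_mul_sub_mem_iff (hK := hK)).2 hab))
  convert this using 1
  rw [C_mul, C_sub]
  ring

theorem IsAdmissiblePair.polynomialSubring_le {s : ℕ → ℚ} {a : ℕ → K}
    (h : IsAdmissiblePair K s a) : polynomialSubring (plus K) ≤ pairSubring K hK s a := by
  have hτ := isMonomialFamily_tPow (hK := hK)
  refine polynomialSubring_le_iff.2 ⟨fun c hc => C_mem_adjoinSubring _ hc, ?_⟩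
  have h1 : C (tPow K hK (s 0)) ∈ pairSubring K hK s a :=
    C_mem_adjoinSubring _ ((hτ.mem_iff _).2 (h.nonneg 0))
  have := Subring.add_mem _ (Subring.mul_mem _ h1 (generator_mem_pairSubring s a 0))
    (C_mem_adjoinSubring _ (h.mem_plus 0))
  rwa [← mul_assoc, ← C_mul, mul_inv_cancel₀ (hτ.ne_zero _), C_1, one_mul,
    sub_add_cancel] at this

/-- Each element of the ring takes values in `K⁺` at all `a i` with `i` large, whereas the constant
`t^(-1)` never does. -/
theorem IsAdmissiblePair.pairSubring_ne_top {s : ℕ → ℚ} {a : ℕ → K}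
    (h : IsAdmissiblePair K s a) : pairSubring K hK s a ≠ ⊤ := by
  have hτ := isMonomialFamily_tPow (hK := hK)
  have hall : ∀ f ∈ pairSubring K hK s a, ∃ n, ∀ i ≥ n, f.eval (a i) ∈ plus K := by
    intro f hf
    refine adjoinSubring_induction (p := fun f => ∃ n, ∀ i ≥ n, f.eval (a i) ∈ plus K) ?_ ?_ ?_ ?_ hf
    · rintro _ ⟨n, rfl⟩
      refine ⟨n, fun i hi => ?_⟩
      rw [eval_mul, eval_C, eval_sub, eval_X, eval_C, inv_tPow_mul_sub_mem_iff]
      exact fun u hu => h.coeff_sub_eq_zero hi hu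
    · exact fun c hc => ⟨0, fun i _ => by rwa [eval_C]⟩
    · rintro f g ⟨n, hn⟩ ⟨m, hm⟩
      refine ⟨max n m, fun i hi => ?_⟩
      rw [eval_add]
      exact Subring.add_mem _ (hn i ((le_max_left _ _).trans hi)) (hm i ((le_max_right _ _).trans hi))
    · rintro f g ⟨n, hn⟩ ⟨m, hm⟩
      refine ⟨max n m, fun i hi => ?_⟩
      rw [eval_mul]
      exact Subring.mul_mem _ (hn i ((le_max_left _ _).trans hi)) (hm i ((le_max_right _ _).trans hi))
  intro ht
  obtain ⟨n, hn⟩ := hall (C (tPow K hK (-1))) (ht ▸ Subring.mem_top _)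
  have := hn n le_rfl
  rw [eval_C, hτ.mem_iff] at this
  linarith

theorem IsAdmissiblePair.isMaximalSubring {s : ℕ → ℚ} {a : ℕ → K} (h : IsAdmissiblePair K s a)
    (hlim : Tendsto s atTop atTop ∨ ¬ ∃ b : K, IsLimitOfPair K s a b) :
    IsMaximalSubring (pairSubring K hK s a) := by
  have hτ := isMonomialFamily_tPow (hK := hK)
  have hle : polynomialSubring (plus K) ≤ pairSubring K hK s a := h.polynomialSubring_le
  have hC := (polynomialSubring_le_iff.1 hle).1
  -- With a limit `b` the orders tend to infinity and the ring is that of the point `b`; without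
  -- one, every linear polynomial is nearly constant.
  by_cases hb : ∃ b : K, IsLimitOfPair K s a b
  · have htend := hlim.resolve_right (not_not.2 hb)
    obtain ⟨b, hb⟩ := hb
    rw [isLimitOfPair_iff] at hb
    have hbV : b ∈ plus K := by
      rw [mem_plus_iff]
      intro u hu
      have h1 := hb 0 u (hu.trans_le (h.nonneg 0))
      rwa [HahnSeries.coeff_sub, mem_plus_iff.1 (h.mem_plus 0) u hu, sub_zero] at h1
    have heq : pairSubring K hK s a = pointSubring (plus K) b := by
      refine adjoinSubring_eq_pointSubring hτ hbV ?_ fun r => ?_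
      · rintro _ ⟨i, rfl⟩
        rw [eval_mul, eval_C, eval_sub, eval_X, eval_C, inv_tPow_mul_sub_mem_iff]
        exact hb i
      · obtain ⟨i, hi⟩ := (htend.eventually_ge_atTop r).exists
        refine C_inv_mul_mem_of_le hτ hle hi (inv_tPow_mul_mem_of_coeff_eq hC (fun u hu => ?_)
          (generator_mem_pairSubring s a i))
        have := hb i u hu
        rw [HahnSeries.coeff_sub, sub_eq_zero] at this ⊢
        exact this.symm
    rw [heq]
    exact isMaximalSubring_pointSubring hτ hbV
  · refine isMaximalSubring_of_forall_linear hτ hle h.pairSubring_ne_top fun c => ?_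
    have hc : ∃ i, (tPow K hK (s i))⁻¹ * (c - a i) ∉ plus K := by
      by_contra! hcon
      exact hb ⟨c, isLimitOfPair_iff.2 fun i => inv_tPow_mul_sub_mem_iff.1 (hcon i)⟩
    obtain ⟨i, hi⟩ := hc
    have hne : c - a i ≠ 0 := by
      intro h0
      rw [h0, mul_zero] at hi
      exact hi (Subring.zero_mem _)
    obtain ⟨e, u, hu, hu', hu0, he⟩ := hτ.exists_eq_mul _ hne
    rw [he, ← mul_assoc, hτ.div_eq, hτ.mul_mem_iff hu hu' hu0, hτ.mem_iff, not_le] at hi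
    -- `y - c = -(c - a i) * (1 - (y - a i)/(c - a i))`, and since `c - a i = t^e u` with `e < s i`,
    -- the quotient is `t^(s i - e) u⁻¹` times a generator.
    refine ⟨-(c - a i), s i - e, by linarith, -(C u⁻¹ * (C (tPow K hK (s i))⁻¹ * (X - C (a i)))),
      Subring.neg_mem _ (Subring.mul_mem _ (hC _ hu') (generator_mem_pairSubring s a i)), ?_⟩
    have h1 : (c - a i) * tPow K hK (s i - e) * u⁻¹ * (tPow K hK (s i))⁻¹ = 1 := by
      rw [he, ← hτ.div_eq]
      field_simp [hτ.ne_zero e, hτ.ne_zero (s i), hu0]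
    have h2 := congrArg (C : K →+* K[X]) h1
    simp only [C_mul, C_1, C_sub, C_neg] at h2 ⊢
    linear_combination (-(X - C (a i))) * h2

theorem maximal_iff_exists_isAdmissiblePair (hcut : HasCutoffProperty K) (A : Subring K[X]) :
    (IsMaximalSubring A ∧ polynomialSubring (plus K) ≤ A) ↔
      ∃ (s : ℕ → ℚ) (a : ℕ → K), IsAdmissiblePair K s a ∧
        (Tendsto s atTop atTop ∨ ¬ ∃ b : K, IsLimitOfPair K s a b) ∧
        A = pairSubring K hK s a := by
  have hτ := isMonomialFamily_tPow (hK := hK)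
  constructor
  · rintro ⟨hmax, hle⟩
    have hC := (polynomialSubring_le_iff.1 hle).1
    have main : ∀ (s : ℕ → ℚ) (b : ℕ → K), (∀ i, 0 ≤ s i) → StrictMono s →
        (∀ i, b i ∈ plus K) → (∀ i, C (tPow K hK (s i))⁻¹ * (X - C (b i)) ∈ A) →
        (Tendsto s atTop atTop ∨ ∀ c, ∃ i, C (tPow K hK (s i))⁻¹ * (X - C c) ∉ A) →
        ∃ (s : ℕ → ℚ) (a : ℕ → K), IsAdmissiblePair K s a ∧
          (Tendsto s atTop atTop ∨ ¬ ∃ b : K, IsLimitOfPair K s a b) ∧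
          A = pairSubring K hK s a := by
      intro s b hs hmono hb hbA hlim
      obtain ⟨a, ha, hab⟩ := hcut.exists_isAdmissiblePair hs hmono hb (by
        intro i u hu
        have h1 := C_inv_mul_mem_of_le hτ hle (hmono (Nat.lt_succ_self i)).le (hbA (i + 1))
        have := inv_tPow_mul_sub_mem_iff.1 (inv_mul_sub_mem hτ hle hmax.1 h1 (hbA i)) u hu
        rwa [HahnSeries.coeff_sub, sub_eq_zero] at this)
      have haA : ∀ i, C (tPow K hK (s i))⁻¹ * (X - C (a i)) ∈ A := fun i =>
        inv_tPow_mul_mem_of_coeff_eq hC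
          (fun u hu => by rw [HahnSeries.coeff_sub, hab i u hu, sub_self]) (hbA i)
      have hlim' : Tendsto s atTop atTop ∨ ¬ ∃ b : K, IsLimitOfPair K s a b := by
        refine hlim.imp id ?_
        rintro hno ⟨c, hc⟩
        obtain ⟨i, hi⟩ := hno c
        refine hi (inv_tPow_mul_mem_of_coeff_eq hC (fun u hu => ?_) (haA i))
        have := isLimitOfPair_iff.1 hc i u hu
        rw [HahnSeries.coeff_sub, sub_eq_zero] at this ⊢
        exact this.symm
      refine ⟨s, a, ha, hlim', ?_⟩
      have hsub : pairSubring K hK s a ≤ A := adjoinSubring_le hC (by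
        rintro _ ⟨i, rfl⟩
        exact haA i)
      exact ((ha.isMaximalSubring hlim').2 A hsub).resolve_right hmax.1
    rcases exists_center_or_sequence hτ hle hmax with ⟨b, hb, hbA⟩ | ⟨s, b, hs, hm, hb, hbA, hno⟩
    -- A center `b` of all orders is turned into a pair by truncating it at the natural numbers.
    · exact main (fun i => i) (fun _ => b) (fun i => Nat.cast_nonneg i) Nat.strictMono_cast
        (fun _ => hb) (fun i => hbA i) (Or.inl tendsto_natCast_atTop_atTop)
    · exact main s b hs hm hb hbA (Or.inr hno)
  · rintro ⟨s, a, ha, hlim, rfl⟩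
    exact ⟨ha.isMaximalSubring hlim, ha.polynomialSubring_le⟩

end Subring

end Pairs

/-! ### Maximal subrings over the Hahn field -/

section HahnMaximal

variable {k : Type*} [Field k]

theorem hahnGeneratedSubring_eq_pointSubring {b : HahnField k} (hb : b ∈ hahnPlus k) :
    hahnGeneratedSubring b = pointSubring (hahnPlus k) b := by
  have hτ := isMonomialFamily_single (k := k)
  have hgen : ∀ n : ℕ, 1 ≤ n →
      C (HahnSeries.single (n : ℚ) (1 : k))⁻¹ * (X - C b) ∈ hahnGeneratedSubring b :=
    fun n hn => subset_adjoinSubring _ _ ⟨n, hn, rfl⟩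
  have hle : polynomialSubring (hahnPlus k) ≤ hahnGeneratedSubring b := by
    refine polynomialSubring_le_iff.2 ⟨fun c hc => C_mem_adjoinSubring _ hc, ?_⟩
    have h1 : C (HahnSeries.single ((1 : ℕ) : ℚ) (1 : k)) ∈ hahnGeneratedSubring b :=
      C_mem_adjoinSubring _ ((hτ.mem_iff _).2 (by simp))
    have := Subring.add_mem _ (Subring.mul_mem _ h1 (hgen 1 le_rfl)) (C_mem_adjoinSubring _ hb)
    rwa [← mul_assoc, ← C_mul, mul_inv_cancel₀ (hτ.ne_zero _), C_1, one_mul,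
      sub_add_cancel] at this
  refine adjoinSubring_eq_pointSubring hτ hb ?_ fun s => ?_
  · rintro _ ⟨n, -, rfl⟩
    simp
  · obtain ⟨n, hn⟩ := exists_nat_ge s
    exact C_inv_mul_mem_of_le hτ hle (hn.trans (by exact_mod_cast Nat.le_succ n))
      (hgen (n + 1) (by omega))

/-- The second alternative of `exists_center_or_sequence` cannot occur: its centers are compatible,
and the series glued from them would be a center reaching every order of the sequence. -/
theorem exists_eq_pointSubring [IsAlgClosed k] {A : Subring (HahnField k)[X]}
    (hmax : IsMaximalSubring A) (hle : polynomialSubring (hahnPlus k) ≤ A) :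
    ∃ b ∈ hahnPlus k, A = pointSubring (hahnPlus k) b := by
  have hτ := isMonomialFamily_single (k := k)
  have hC := (polynomialSubring_le_iff.1 hle).1
  rcases exists_center_or_sequence hτ hle hmax with ⟨b, hb, hbA⟩ | ⟨s, b, -, hm, -, hbA, hno⟩
  · refine ⟨b, hb, ?_⟩
    have hsub : pointSubring (hahnPlus k) b ≤ A := by
      rw [← hahnGeneratedSubring_eq_pointSubring hb]
      refine adjoinSubring_le hC ?_
      rintro _ ⟨n, -, rfl⟩
      exact hbA n
    exact ((isMaximalSubring_pointSubring hτ hb).2 A hsub).resolve_right hmax.1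
  · exfalso
    obtain ⟨c, hc⟩ := exists_coeff_eq_of_compatible (Set.range fun i => (s i, b i)) (by
      rintro _ ⟨i, rfl⟩ _ ⟨j, rfl⟩ hij u hu
      have h1 := C_inv_mul_mem_of_le hτ hle hij (hbA j)
      have := inv_single_mul_mem_iff.1 (inv_mul_sub_mem hτ hle hmax.1 (hbA i) h1) u hu
      rwa [HahnSeries.coeff_sub, sub_eq_zero] at this)
    obtain ⟨i, hi⟩ := hno c
    refine hi ?_
    have h1 : (HahnSeries.single (s i) (1 : k))⁻¹ * (b i - c) ∈ hahnPlus k := by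
      rw [inv_single_mul_mem_iff]
      intro u hu
      rw [HahnSeries.coeff_sub, hc _ ⟨i, rfl⟩ u hu, sub_self]
    have := A.add_mem (hbA i) (hC _ h1)
    convert this using 1
    rw [C_mul, C_sub]
    ring

end HahnMaximal

/-! ### The crucial maximal ideal -/

section Crucial

variable {k : Type*} [Field k]

/-- The monomial `t`, as an element of `V + (y - b) K[y]`. -/
noncomputable def uniformizer (b : HahnField k) : pointSubring (hahnPlus k) b :=
  ⟨C (HahnSeries.single 1 1), by
    rw [mem_pointSubring_iff, eval_C]
    exact (isMonomialFamily_single.mem_iff 1).2 zero_le_one⟩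

theorem mem_pointIdeal_iff {b : HahnField k} {f : pointSubring (hahnPlus k) b} :
    f ∈ pointIdeal (hahnPlus k) (hahnMaximalIdeal k) b ↔
      0 < HahnSeries.addVal ℚ k ((f : (HahnField k)[X]).eval b) := by
  constructor
  · rintro ⟨c, hc, g, hf⟩
    rw [hf]
    simpa using (mem_hahnMaximalIdeal k).1 hc
  · intro hf
    obtain ⟨g, hg⟩ := X_sub_C_dvd_sub_C_eval (a := b) (p := (f : (HahnField k)[X]))
    exact ⟨⟨_, mem_pointSubring_iff.1 f.2⟩, (mem_hahnMaximalIdeal k).2 hf, g, by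
      rw [← hg]; ring⟩

theorem isMaximal_pointIdeal (b : HahnField k) :
    (pointIdeal (hahnPlus k) (hahnMaximalIdeal k) b).IsMaximal := by
  have := (isMaximal_iff_eq_hahnMaximalIdeal (hahnMaximalIdeal k)).2 rfl
  let ev : pointSubring (hahnPlus k) b →+* hahnPlus k :=
    ((evalRingHom b).comp (pointSubring (hahnPlus k) b).subtype).codRestrict _
      fun f => mem_pointSubring_iff.1 f.2
  have hev : Function.Surjective ev := fun c =>
    ⟨⟨C c, by rw [mem_pointSubring_iff, eval_C]; exact c.2⟩, Subtype.ext (eval_C)⟩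
  have heq : pointIdeal (hahnPlus k) (hahnMaximalIdeal k) b =
      (hahnMaximalIdeal k).comap ev := by
    ext f
    rw [mem_pointIdeal_iff, Ideal.mem_comap, mem_hahnMaximalIdeal]
    rfl
  rw [heq]
  exact Ideal.comap_isMaximal_of_surjective ev hev

theorem uniformizer_mem_pointIdeal (b : HahnField k) :
    uniformizer b ∈ pointIdeal (hahnPlus k) (hahnMaximalIdeal k) b := by
  rw [mem_pointIdeal_iff, uniformizer, eval_C, HahnSeries.addVal_apply,
    HahnSeries.orderTop_single one_ne_zero]
  exact_mod_cast one_pos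

/-- If `f(b)` has positive valuation, then a power of `f` is divisible by `t` in the ring, because
the value group is archimedean. -/
theorem pointIdeal_le_of_uniformizer_mem {b : HahnField k}
    (p : Ideal (pointSubring (hahnPlus k) b)) [hp : p.IsPrime] (ht : uniformizer b ∈ p) :
    pointIdeal (hahnPlus k) (hahnMaximalIdeal k) b ≤ p := by
  have hτ := isMonomialFamily_single (k := k)
  intro f hf
  rw [mem_pointIdeal_iff] at hf
  have hn : ∃ n : ℕ, (HahnSeries.single 1 1)⁻¹ * ((f : (HahnField k)[X]) ^ n).eval b ∈
      hahnPlus k := by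
    set x := (f : (HahnField k)[X]).eval b
    simp only [eval_pow]
    rcases eq_or_ne x 0 with h0 | h0
    · exact ⟨1, by rw [pow_one]; change _ * x ∈ _; rw [h0, mul_zero]; exact Subring.zero_mem _⟩
    rw [HahnSeries.addVal_apply, ← HahnSeries.order_eq_orderTop_of_ne_zero h0] at hf
    have hpos : 0 < x.order := by exact_mod_cast hf
    obtain ⟨n, hn⟩ := exists_nat_ge (1 / x.order)
    rw [div_le_iff₀ hpos] at hn
    refine ⟨n, inv_single_mul_mem_iff.2 fun u hu => HahnSeries.coeff_eq_zero_of_lt_order ?_⟩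
    rw [HahnSeries.order_pow, nsmul_eq_mul]
    linarith
  obtain ⟨n, hn⟩ := hn
  refine hp.mem_of_pow_mem n ?_
  have hg : C (HahnSeries.single 1 1)⁻¹ * (f : (HahnField k)[X]) ^ n ∈
      pointSubring (hahnPlus k) b := by
    rw [mem_pointSubring_iff, eval_mul, eval_C]
    exact hn
  have : f ^ n = uniformizer b * ⟨_, hg⟩ := by
    refine Subtype.ext ?_
    change (f : (HahnField k)[X]) ^ n = C (HahnSeries.single 1 1) * _
    rw [← mul_assoc, ← C_mul, mul_inv_cancel₀ (hτ.ne_zero 1), C_1, one_mul]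
  rw [this]
  exact p.mul_mem_right _ ht

theorem isUnit_subtype_uniformizer (b : HahnField k) :
    IsUnit ((pointSubring (hahnPlus k) b).subtype (uniformizer b)) := by
  change IsUnit (C (HahnSeries.single 1 1))
  rw [isUnit_C, isUnit_iff_ne_zero]
  exact isMonomialFamily_single.ne_zero 1

theorem comap_subtype_ne_pointIdeal (b : HahnField k) (q : PrimeSpectrum (HahnField k)[X]) :
    (PrimeSpectrum.comap (pointSubring (hahnPlus k) b).subtype q).asIdeal ≠
      pointIdeal (hahnPlus k) (hahnMaximalIdeal k) b := by
  intro h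
  have : uniformizer b ∈ (PrimeSpectrum.comap (pointSubring (hahnPlus k) b).subtype q).asIdeal :=
    h ▸ uniformizer_mem_pointIdeal b
  exact q.2.ne_top (Ideal.eq_top_of_isUnit_mem _ this (isUnit_subtype_uniformizer b))

/-- Multiplying `f` by a high power of `t` moves `f(b)` into `K⁺`, so every polynomial is a fraction
with a power of `t` as denominator. -/
theorem isLocalization_away_uniformizer (b : HahnField k) :
    IsLocalization.Away (uniformizer b) (HahnField k)[X] := by
  have hτ := isMonomialFamily_single (k := k)
  refine IsLocalization.Away.mk _ (isUnit_subtype_uniformizer b) (fun f => ?_)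
    fun x y hxy => ⟨0, by rw [Subtype.ext hxy]⟩
  suffices h : ∃ n : ℕ, f.eval b * HahnSeries.single 1 1 ^ n ∈ hahnPlus k by
    obtain ⟨n, hn⟩ := h
    refine ⟨n, ⟨f * C (HahnSeries.single 1 1) ^ n, ?_⟩, rfl⟩
    rw [mem_pointSubring_iff, eval_mul, eval_pow, eval_C]
    exact hn
  rcases eq_or_ne (f.eval b) 0 with h0 | h0
  · exact ⟨0, by simp [h0]⟩
  obtain ⟨s, u, hu, hu', hu0, hs⟩ := hτ.exists_eq_mul _ h0
  obtain ⟨n, hn⟩ := exists_nat_ge (-s)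
  refine ⟨n, ?_⟩
  rw [hs, mul_right_comm, hτ.mul_mem_iff hu hu' hu0]
  have h1 := hτ.map_nsmul n 1
  rw [mul_one] at h1
  rw [← h1, ← single_add_eq_mul, hτ.mem_iff]
  linarith

theorem not_surjective_comap_subtype (b : HahnField k) :
    ¬ Function.Surjective (PrimeSpectrum.comap (pointSubring (hahnPlus k) b).subtype) := by
  intro hs
  obtain ⟨q, hq⟩ := hs ⟨_, (isMaximal_pointIdeal b).isPrime⟩
  exact comap_subtype_ne_pointIdeal b q (congrArg PrimeSpectrum.asIdeal hq)

theorem isCrucialMaximalIdeal_iff (b : HahnField k)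
    (m : Ideal (pointSubring (hahnPlus k) b)) :
    IsCrucialMaximalIdeal (pointSubring (hahnPlus k) b) m ↔
      m = pointIdeal (hahnPlus k) (hahnMaximalIdeal k) b := by
  constructor
  · rintro ⟨hm, hiso⟩
    by_contra hne
    -- If `m` were another ideal, the point ideal would lie in the image of `Spec K[y]`, although it
    -- contains `t`, a unit of `K[y]`.
    obtain ⟨y, hy⟩ := (AlgebraicGeometry.morphismRestrict
      (AlgebraicGeometry.Spec.map (CommRingCat.ofHom (pointSubring (hahnPlus k) b).subtype))
      (complOfClosedPoint m hm)).surjective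
      ⟨⟨_, (isMaximal_pointIdeal b).isPrime⟩,
        fun h => hne (congrArg PrimeSpectrum.asIdeal h).symm⟩
    have h1 := congrArg Subtype.val hy
    rw [AlgebraicGeometry.morphismRestrict_base_coe] at h1
    exact comap_subtype_ne_pointIdeal b _ (congrArg PrimeSpectrum.asIdeal h1)
  · rintro rfl
    refine ⟨isMaximal_pointIdeal b, ?_⟩
    have hloc := isLocalization_away_uniformizer b
    have hopen : AlgebraicGeometry.IsOpenImmersion (AlgebraicGeometry.Spec.map
        (CommRingCat.ofHom (pointSubring (hahnPlus k) b).subtype)) :=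
      AlgebraicGeometry.IsOpenImmersion.of_isLocalization (uniformizer b)
    -- Localization at `t` is an open immersion, so only surjectivity onto the complement is left: a
    -- prime other than the point ideal does not contain `t`, hence comes from `K[y]`.
    refine AlgebraicGeometry.isIso_of_isOpenImmersion_of_opensRange_eq_top _ (top_unique ?_)
    rintro ⟨p, hp⟩ -
    have hpt : uniformizer b ∉ p.asIdeal := by
      intro ht
      have hle := pointIdeal_le_of_uniformizer_mem (hp := p.2) p.asIdeal ht
      exact hp (PrimeSpectrum.ext
        ((isMaximal_pointIdeal b).eq_of_le p.2.ne_top hle).symm)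
    have hrange := PrimeSpectrum.localization_away_comap_range (HahnField k)[X] (uniformizer b)
    obtain ⟨q, hq⟩ : p ∈ Set.range (PrimeSpectrum.comap
        (algebraMap (pointSubring (hahnPlus k) b) (HahnField k)[X])) := by
      rw [hrange]
      exact hpt
    refine ⟨⟨q, ?_⟩, Subtype.ext ?_⟩
    · change PrimeSpectrum.comap _ q ∈ complOfClosedPoint _ (isMaximal_pointIdeal b)
      exact hq ▸ hp
    · exact (AlgebraicGeometry.morphismRestrict_base_coe _ _ _).trans hq

end Crucial

end MaxSubring

theorem mainTheorem5 (k : Type*) [Field k] [IsAlgClosed k] :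
    -- the classification by admissible pairs over a field with the cutoff property
    (∀ (K : Subfield (HahnField k)) [IsAlgClosed K] (hK : rationalFunctions k ≤ K),
      HasCutoffProperty K → ∀ A : Subring K[X],
        (IsMaximalSubring A ∧ polynomialSubring (plus K) ≤ A) ↔
          ∃ (s : ℕ → ℚ) (a : ℕ → K), IsAdmissiblePair K s a ∧
            (Tendsto s atTop atTop ∨ ¬ ∃ b : K, IsLimitOfPair K s a b) ∧
            A = pairSubring K hK s a) ∧
    -- over the Hahn field: the rings generated by all `(y - α) / tⁿ`
    (∀ α ∈ hahnPlus k, IsMaximalSubring (hahnGeneratedSubring α) ∧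
      polynomialSubring (hahnPlus k) ≤ hahnGeneratedSubring α) ∧
    (∀ A : Subring (HahnField k)[X], IsMaximalSubring A → polynomialSubring (hahnPlus k) ≤ A →
      ∃ α ∈ hahnPlus k, A = hahnGeneratedSubring α) ∧
    -- these rings are `K⁺ + (y - α) K[y]`, with crucial maximal ideal `𝔫 + (y - α) K[y]`
    (∀ α ∈ hahnPlus k, hahnGeneratedSubring α = pointSubring (hahnPlus k) α ∧
      ∀ m : Ideal (pointSubring (hahnPlus k) α),
        IsCrucialMaximalIdeal (pointSubring (hahnPlus k) α) m ↔
          m = pointIdeal (hahnPlus k) (hahnMaximalIdeal k) α) ∧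
    -- the bijection onto the maximal subrings containing `K⁺[y]`
    Set.BijOn (fun α : HahnField k => pointSubring (hahnPlus k) α) (hahnPlus k)
      {A | IsMaximalSubring A ∧ polynomialSubring (hahnPlus k) ≤ A} ∧
    -- the bijection onto the extending maximal `k`-subalgebras containing `K⁺[y]`
    Set.BijOn (fun α : HahnField k => pointSubring (hahnPlus k) α) (hahnPlus k)
      {A | IsMaximalSubalgebra (constants k) A ∧ IsExtendingMaximalSubring A ∧
        polynomialSubring (hahnPlus k) ≤ A} := by
  have hτ := isMonomialFamily_single (k := k)
  have hmaps : ∀ α ∈ hahnPlus k, IsMaximalSubring (pointSubring (hahnPlus k) α) ∧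
      polynomialSubring (hahnPlus k) ≤ pointSubring (hahnPlus k) α := fun α hα =>
    ⟨isMaximalSubring_pointSubring hτ hα, polynomialSubring_le_pointSubring hα⟩
  refine ⟨?_, ?_, ?_, ?_, ?_, ?_⟩
  · intro K _ hK hcut A
    exact maximal_iff_exists_isAdmissiblePair hcut A
  · intro α hα
    rw [hahnGeneratedSubring_eq_pointSubring hα]
    exact hmaps α hα
  · intro A hmax hle
    obtain ⟨b, hb, rfl⟩ := exists_eq_pointSubring hmax hle
    exact ⟨b, hb, (hahnGeneratedSubring_eq_pointSubring hb).symm⟩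
  · exact fun α hα => ⟨hahnGeneratedSubring_eq_pointSubring hα, isCrucialMaximalIdeal_iff α⟩
  · refine ⟨hmaps, fun a _ b _ hab => pointSubring_injective hτ hab, ?_⟩
    rintro A ⟨hmax, hle⟩
    obtain ⟨b, hb, rfl⟩ := exists_eq_pointSubring hmax hle
    exact ⟨b, hb, rfl⟩
  · refine ⟨fun α hα => ⟨⟨?_, (hmaps α hα).1.1, fun B _ => (hmaps α hα).1.2 B⟩,
      ⟨(hmaps α hα).1, not_surjective_comap_subtype α⟩, (hmaps α hα).2⟩,
      fun a _ b _ hab => pointSubring_injective hτ hab, ?_⟩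
    · rintro _ ⟨c, rfl⟩
      change C (HahnSeries.C c) ∈ pointSubring (hahnPlus k) α
      rw [mem_pointSubring_iff, eval_C, mem_hahnPlus_iff_coeff]
      exact fun u hu => HahnSeries.coeff_single_of_ne hu.ne
    · rintro A ⟨-, ⟨hmax, -⟩, hle⟩
      obtain ⟨b, hb, rfl⟩ := exists_eq_pointSubring hmax hle
      exact ⟨b, hb, rfl⟩
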